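/- Let $n\ge 0$ and let $\lambda=(\lambda_1\ge\dots\ge\lambda_n)$ be a dominant integral weight of $\mathfrak{gl}_n$ (the case of interest is that of a singular $\lambda$, i.e. one whose coordinates are not pairwise distinct). The Gelfand–Tsetlin polytope $GT_\lambda\subset\mathbb R^{\binom{n+1}{2}}$ is the set of real triangles $A=(A_{i,j})_{0\le i\le n-1,\,1\le j\le n-i}$ with $A_{0,j}=\lambda_j$ and $A_{i,j}\ge A_{i+1,j}\ge A_{i,j+1}$. The weight $\mu_A\in\mathbb R^n$ of a triangle $A$ has coordinates $(\mu_A)_i=\sum_j A_{i-1,j}-\sum_j A_{i,j}$ for $1\le i\le n$, where $A_{n,j}=0$. For a set $P\subset\mathbb R^m$ let $S(P)=\sum_{a\in P\cap\mathbb Z^m}\mathbf t^a$; if $q\,S(P)$ is a Laurent polynomial for some nonzero Laurent polynomial $q$ with integer coefficients, let $\sigma(P)$ be the rational function $\frac{qS(P)}{q}$. For a vertex $v$ of $GT_\lambda$ let $C_v=\{v+t(a-v): a\in GT_\lambda,\ t\ge 0\}$ be its tangent cone. Let $F$ be the specialization $t_{0,j}\mapsto x_1$ and $t_{i,j}\mapsto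 x_i^{-1}x_{i+1}$ for $i>0$ (applied to rational functions that are fractions of Laurent polynomials with denominator not specializing to $0$). The group $S_n$ acts on weights by permuting coordinates, $(w\lambda)_i=\lambda_{w^{-1}(i)}$, and on rational functions in $x_1,\dots,x_n$ by $x_i\mapsto x_{w(i)}$; write $e^\lambda=x_1^{\lambda_1}\cdots x_n^{\lambda_n}$. **Theorem.** For every vertex $v$ of $GT_\lambda$ the rational functions $\sigma(C_v)$ and $F(\sigma(C_v))$ are well defined. The vertices $v$ of $GT_\lambda$ with $F(\sigma(C_v))\ne 0$ are in bijection $\mu\mapsto v_\mu$ with the elements $\mu$ of the orbit $S_n\lambda$, where $v_\mu$ has weight $\mu$, and for every $\mu\in S_n\lambda$ $$F(\sigma(C_{v_\mu}))=\sum_{w\in S_n,\ w\lambda=\mu} w\left(\frac{e^\lambda}{\prod_{1\le i<j\le n}\left(1-x_j/x_i\right)}\right).$$ -/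

import Mathlib

/-! ### Rational functions and integer-point transforms -/

/-- The field of rational functions (over `ℚ`) in variables indexed by `ι`. -/
abbrev RatFn (ι : Type) : Type := FractionRing (MvPolynomial ι ℚ)

/-- The variable indexed by `i`, as a rational function. -/
noncomputable def RatFn.var {ι : Type} (i : ι) : RatFn ι :=
  algebraMap (MvPolynomial ι ℚ) (RatFn ι) (MvPolynomial.X i)

/-- Laurent polynomials with integer coefficients in variables indexed by `ι`: finite integer
combinations of exponent vectors `a : ι → ℤ`. -/
abbrev LaurentPoly (ι : Type) : Type := AddMonoidAlgebra ℤ (ι → ℤ)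

/-- The value of a Laurent polynomial at a family `y` of (nonzero) elements of a field. -/
noncomputable def LaurentPoly.evalAt {ι : Type} [Fintype ι] {K : Type} [Field K]
    (y : ι → K) (q : LaurentPoly ι) : K :=
  q.coeff.sum fun a c => (c : K) * ∏ i, y i ^ a i

open Classical in
/-- The formal series `S(P) = ∑_{a ∈ P ∩ ℤ^ι} x^a`, given by its coefficients. -/
noncomputable def genSeries {ι : Type} (P : Set (ι → ℝ)) : (ι → ℤ) → ℤ :=
  fun a => if (fun i => (a i : ℝ)) ∈ P then 1 else 0

/-- The product of a Laurent polynomial and a formal (two-sided) Laurent series. -/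
noncomputable def LaurentPoly.mulSeries {ι : Type} (q : LaurentPoly ι) (S : (ι → ℤ) → ℤ) :
    (ι → ℤ) → ℤ :=
  fun a => q.coeff.sum fun b c => c * S (a - b)

/-- `Q` is the integer-point transform of `P`: for some nonzero Laurent polynomial `q` the product
`q * S(P)` is a Laurent polynomial `p`, and `Q = p / q`. -/
def IsIntegerPointTransform {ι : Type} [Fintype ι] (P : Set (ι → ℝ)) (Q : RatFn ι) : Prop :=
  ∃ p q : LaurentPoly ι, q ≠ 0 ∧ (∀ a, q.mulSeries (genSeries P) a = p.coeff a) ∧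
    Q = p.evalAt RatFn.var / q.evalAt RatFn.var

open Classical in
/-- The integer-point transform `σ(P)` (zero if there is none). -/
noncomputable def sigma {ι : Type} [Fintype ι] (P : Set (ι → ℝ)) : RatFn ι :=
  if h : ∃ Q, IsIntegerPointTransform P Q then h.choose else 0

/-- `r` is the result of substituting `y i` for the variable `i` in the rational function `Q`:
`Q` is a fraction of Laurent polynomials whose denominator does not vanish at `y`, and `r` is the
value of that fraction at `y`. -/
def IsSpecialization {ι : Type} [Fintype ι] {K : Type} [Field K] (y : ι → K)
    (Q : RatFn ι) (r : K) : Prop :=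
  ∃ p q : LaurentPoly ι, q.evalAt y ≠ 0 ∧ Q = p.evalAt RatFn.var / q.evalAt RatFn.var ∧
    r = p.evalAt y / q.evalAt y

/-! ### Polytopes -/

/-- The tangent cone of a convex set `P` at `v`, with apex `v`. -/
def tangentConeAtVertex {ι : Type} (P : Set (ι → ℝ)) (v : ι → ℝ) : Set (ι → ℝ) :=
  {x | ∃ a ∈ P, ∃ t : ℝ, 0 ≤ t ∧ x = v + t • (a - v)}

/-- Positions in a triangle of size `n`. Both the row `i` and the place `j` in the row start from
`0`, so row `i` has the `n - i` places `j = 0, …, n - i - 1`. -/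
abbrev GTIndex (n : ℕ) : Type := {p : Fin n × Fin n // (p.1 : ℕ) + (p.2 : ℕ) < n}

/-- The position `(i, j)`. -/
def GTIndex.mk {n : ℕ} (i j : ℕ) (h : i + j < n) : GTIndex n :=
  ⟨(⟨i, by omega⟩, ⟨j, by omega⟩), h⟩

/-- The row of a position. -/
def GTIndex.row {n : ℕ} (p : GTIndex n) : Fin n := p.1.1

/-- The Gelfand-Tsetlin polytope. -/
def GTPolytope {n : ℕ} (lam : Fin n → ℤ) : Set (GTIndex n → ℝ) :=
  {A | (∀ j : Fin n, A (GTIndex.mk 0 j (by omega)) = lam j) ∧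
    ∀ (i j : ℕ) (h : i + 1 + j < n),
      A (GTIndex.mk (i + 1) j h) ≤ A (GTIndex.mk i j (by omega)) ∧
      A (GTIndex.mk i (j + 1) (by omega)) ≤ A (GTIndex.mk (i + 1) j h)}

/-- The vertices of the Gelfand-Tsetlin polytope. -/
def GTVertices {n : ℕ} (lam : Fin n → ℤ) : Set (GTIndex n → ℝ) :=
  Set.extremePoints ℝ (GTPolytope lam)

/-- The tangent cone `C_v` of the Gelfand-Tsetlin polytope at `v`. -/
def GTCone {n : ℕ} (lam : Fin n → ℤ) (v : GTIndex n → ℝ) : Set (GTIndex n → ℝ) :=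
  tangentConeAtVertex (GTPolytope lam) v

/-- The sum of row `i` of a triangle (zero if there is no such row). -/
noncomputable def rowSum {n : ℕ} (A : GTIndex n → ℝ) (i : ℕ) : ℝ :=
  ∑ p : GTIndex n with (p.row : ℕ) = i, A p

/-- The weight of a triangle: differences of consecutive row sums. -/
noncomputable def gtWeight {n : ℕ} (A : GTIndex n → ℝ) : Fin n → ℝ :=
  fun i => rowSum A i - rowSum A ((i : ℕ) + 1)

/-- The values substituted for the variables `t_{i,j}`. With rows and variables numbered from `0`,
these are `x_0` in row `0` and `x_{i-1}⁻¹ x_i` in row `i > 0`. -/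
noncomputable def gtSubst (n : ℕ) (p : GTIndex n) : RatFn (Fin n) :=
  if (p.row : ℕ) = 0 then RatFn.var p.row
  else (RatFn.var (⟨(p.row : ℕ) - 1, by omega⟩ : Fin n))⁻¹ * RatFn.var p.row

open Classical in
/-- The specialization `F` of rational functions in the `t_{i,j}` to rational functions in the
`x_i` (zero where the specialization is undefined). -/
noncomputable def specF {n : ℕ} (Q : RatFn (GTIndex n)) : RatFn (Fin n) :=
  if h : ∃ r, IsSpecialization (gtSubst n) Q r then h.choose else 0

/-! ### The symmetric group action and Weyl's summands -/

/-- The action of `S_n` on weights by permuting coordinates: `(w λ)_i = λ_{w⁻¹ i}`. -/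
def permWeight {n : ℕ} (w : Equiv.Perm (Fin n)) (lam : Fin n → ℤ) : Fin n → ℤ :=
  fun i => lam (w.symm i)

/-- The orbit `S_n λ`. -/
def weightOrbit {n : ℕ} (lam : Fin n → ℤ) : Set (Fin n → ℤ) :=
  Set.range fun w : Equiv.Perm (Fin n) => permWeight w lam

/-- The action of `S_n` on rational functions: the field automorphism with `x_i ↦ x_{w i}`. -/
noncomputable def permRatFn {n : ℕ} (w : Equiv.Perm (Fin n)) : RatFn (Fin n) ≃+* RatFn (Fin n) :=
  IsFractionRing.ringEquivOfRingEquiv (MvPolynomial.renameEquiv ℚ w).toRingEquiv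

theorem permRatFn_var {n : ℕ} (w : Equiv.Perm (Fin n)) (i : Fin n) :
    permRatFn w (RatFn.var i) = RatFn.var (w i) := by
  simp [permRatFn, RatFn.var]

/-- The monomial `e^μ`. -/
noncomputable def expWeight {n : ℕ} (mu : Fin n → ℤ) : RatFn (Fin n) :=
  ∏ i, RatFn.var i ^ mu i

theorem permRatFn_expWeight {n : ℕ} (w : Equiv.Perm (Fin n)) (mu : Fin n → ℤ) :
    permRatFn w (expWeight mu) = expWeight (permWeight w mu) := by
  simp only [expWeight, permWeight, map_prod, map_zpow₀, permRatFn_var]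
  exact Fintype.prod_equiv w _ _ (fun i => by simp)

/-- The function `e^λ / ∏_{i<j} (1 - x_j / x_i)`. -/
noncomputable def weylTerm {n : ℕ} (lam : Fin n → ℤ) : RatFn (Fin n) :=
  expWeight lam /
    ∏ p : Fin n × Fin n with p.1 < p.2, (1 - RatFn.var p.2 / RatFn.var p.1)

/-!
The tangent cone `C_v` is cut out by the inequalities between neighbouring entries that are
equalities for `v` (`mem_GTCone_iff`), so its integer points can be summed row by row from the
bottom. For a fixed row `i`, equal to `y`, consider the series of all ways to fill the rows below.
It is convenient to admit all integer vectors `y`, counting the points of an interval with reversed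
end points negatively (`signedSeries`); for the dominant top row `λ` no signs occur
(`signedSeries_zero_eq`).

Passing from row `i + 1` to row `i` multiplies by weights of the entries of row `i + 1` and sums
over them, possibly over half-lines or lines. If, after multiplication by a Laurent polynomial, the
series for row `i + 1` is a combination of monomials with exponents linear in the row, every sum is
geometric: `1 - t ^ T` times the sum consists of the boundary terms
(`prod_mulSeries_latticeSeries`). The monomials `t ^ T` that occur do not specialize to `1`
(`specHom_single_ne_one`), so transforms and specializations exist. By independence of characters
(`sum_congr_of_sum_characters`), the specialized value for row `i` depends only on the specialized
values for row `i + 1` as a function of the row, in whatever way this function is written as a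
combination of characters (`HasRowValue.step`).

With `μ` the weight of `v`, the value for row `i` is a constant times
`det ([v_{i,j} = μ_q] x_q ^ (y_j - j))`, up to a shift that depends on the normalization of
row `i` (`hasRowValue_rowValue`). Indeed, the geometric sums turn the determinant of row `i + 1`
into one whose columns are differences of neighbouring columns of the determinant of row `i`. If row
`i + 1` of `v` is row `i` with one entry deleted, these differences are column operations and
the determinant of row `i` results (`det_differenceMatrix`); otherwise some value occurs more often
in row `i + 1` than in row `i`, and the determinant vanishes (`det_differenceMatrix_eq_zero`).

Thus `F(σ(C_v))` vanishes unless every row of `v` deletes one entry of the previous row. Such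
vertices correspond to the weights in the orbit of `λ`: a weight lists the deleted entries
(`exists_vertex`, `eq_of_gtWeight_eq`). For them, the Leibniz expansion of
`det ([λ_j = μ_q] x_q ^ (λ_j - j))` runs over the permutations `w` with `w λ = μ`, and its terms are
Weyl's summands, because the constant is the inverse of a Vandermonde determinant
in the inverses of the variables (`rowValue_zero_eq`). The sum is not zero, as its terms are
distinct monomials up to sign and the common constant.
-/

/-! ### Laurent polynomials acting on formal series -/

namespace LaurentPoly

open AddMonoidAlgebra

variable {ι : Type}

theorem zero_mulSeries (S : (ι → ℤ) → ℤ) : mulSeries 0 S = 0 := by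
  ext a; simp [mulSeries]

theorem add_mulSeries (p q : LaurentPoly ι) (S : (ι → ℤ) → ℤ) :
    (p + q).mulSeries S = p.mulSeries S + q.mulSeries S := by
  ext a
  simp only [mulSeries, coeff_add, Pi.add_apply]
  exact Finsupp.sum_add_index' (by simp) (by intros; ring)

theorem single_mulSeries (b : ι → ℤ) (c : ℤ) (S : (ι → ℤ) → ℤ) (a : ι → ℤ) :
    mulSeries (single b c) S a = c * S (a - b) := by
  simp [mulSeries]

theorem mulSeries_eq_sum (q : LaurentPoly ι) (S : (ι → ℤ) → ℤ) (a : ι → ℤ) :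
    q.mulSeries S a = ∑ b ∈ q.coeff.support, q.coeff b * S (a - b) := rfl

theorem mulSeries_add (q : LaurentPoly ι) (S S' : (ι → ℤ) → ℤ) :
    q.mulSeries (S + S') = q.mulSeries S + q.mulSeries S' := by
  ext a
  simp [mulSeries_eq_sum, mul_add, Finset.sum_add_distrib]

theorem mulSeries_zero (q : LaurentPoly ι) : q.mulSeries 0 = 0 := by
  ext a
  simp [mulSeries_eq_sum]

theorem mul_mulSeries (p q : LaurentPoly ι) (S : (ι → ℤ) → ℤ) :
    (p * q).mulSeries S = p.mulSeries (q.mulSeries S) := by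
  induction p using AddMonoidAlgebra.induction_linear with
  | zero => simp [zero_mulSeries]
  | add p p' hp hp' => rw [add_mul, add_mulSeries, add_mulSeries, hp, hp']
  | single b c =>
    induction q using AddMonoidAlgebra.induction_linear with
    | zero => simp [zero_mulSeries, mulSeries_zero]
    | add q q' hq hq' => rw [mul_add, add_mulSeries, add_mulSeries, mulSeries_add, hq, hq']
    | single b' c' =>
      ext a
      rw [single_mul_single, single_mulSeries, single_mulSeries, single_mulSeries, mul_assoc]
      congr 3
      abel

theorem mulSeries_coeff (p q : LaurentPoly ι) : p.mulSeries q.coeff = (p * q).coeff := by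
  ext a
  rw [coeff_mul_apply_left]
  simp only [mulSeries, sub_eq_neg_add]

theorem sub_mulSeries (p q : LaurentPoly ι) (S : (ι → ℤ) → ℤ) :
    (p - q).mulSeries S = p.mulSeries S - q.mulSeries S := by
  rw [eq_sub_iff_add_eq, ← add_mulSeries, sub_add_cancel]

theorem one_mulSeries (S : (ι → ℤ) → ℤ) : mulSeries 1 S = S := by
  ext a
  rw [one_def, single_mulSeries]
  simp

theorem mulSeries_sum {κ : Type*} (q : LaurentPoly ι) (s : Finset κ) (S : κ → (ι → ℤ) → ℤ) :
    q.mulSeries (∑ k ∈ s, S k) = ∑ k ∈ s, q.mulSeries (S k) := by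
  classical
  induction s using Finset.induction_on with
  | empty => simp [mulSeries_zero]
  | insert a s ha ih => rw [Finset.sum_insert ha, mulSeries_add, ih, Finset.sum_insert ha]

/-! ### Evaluation of Laurent polynomials -/

theorem _root_.RatFn.var_ne_zero (i : ι) : RatFn.var i ≠ 0 := by
  simp [RatFn.var]

variable [Fintype ι] {K : Type} [Field K]

/-- Evaluation of Laurent polynomials at a family of nonzero elements, as a ring homomorphism. -/
noncomputable def evalHom (y : ι → K) (hy : ∀ i, y i ≠ 0) : LaurentPoly ι →+* K :=
  (AddMonoidAlgebra.lift ℤ K (ι → ℤ)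
    { toFun := fun a => ∏ i, y i ^ (Multiplicative.toAdd a i)
      map_one' := by simp
      map_mul' := fun a b => by
        simp [zpow_add₀ (hy _), Finset.prod_mul_distrib] }).toRingHom

theorem evalHom_apply (y : ι → K) (hy : ∀ i, y i ≠ 0) (q : LaurentPoly ι) :
    evalHom y hy q = q.evalAt y := by
  simp [evalHom, evalAt, AddMonoidAlgebra.lift_apply]

theorem evalHom_single (y : ι → K) (hy : ∀ i, y i ≠ 0) (a : ι → ℤ) (c : ℤ) :
    evalHom y hy (single a c) = c * ∏ i, y i ^ a i := by
  simp [evalHom]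

/-- A nonzero Laurent polynomial is a nonzero rational function: after multiplication by a
monomial it becomes a nonzero polynomial. -/
theorem evalAt_var_ne_zero {q : LaurentPoly ι} (hq : q ≠ 0) : q.evalAt RatFn.var ≠ 0 := by
  classical
  intro h0
  apply hq
  -- `b` bounds the negative parts of all exponents of `q`
  let b : ι → ℤ := fun i => ∑ a ∈ q.coeff.support, |a i|
  have hb : ∀ a ∈ q.coeff.support, ∀ i, 0 ≤ a i + b i := by
    intro a ha i
    have : |a i| ≤ b i :=
      Finset.single_le_sum (f := fun a : ι → ℤ => |a i|) (fun _ _ => abs_nonneg _) ha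
    have := neg_abs_le (a i)
    omega
  let f : (ι → ℤ) → (ι →₀ ℕ) := fun a => Finsupp.equivFunOnFinite.symm fun i => (a i + b i).toNat
  have hf : Set.InjOn f q.coeff.support := by
    intro a ha a' ha' h
    ext i
    have hi : (a i + b i).toNat = (a' i + b i).toNat := DFunLike.congr_fun h i
    have h1 := hb a ha i
    have h2 := hb a' ha' i
    omega
  let P : MvPolynomial ι ℚ :=
    ∑ a ∈ q.coeff.support, MvPolynomial.monomial (f a) (q.coeff a : ℚ)
  have hP : algebraMap (MvPolynomial ι ℚ) (RatFn ι) P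
      = q.evalAt RatFn.var * ∏ i, RatFn.var i ^ b i := by
    simp only [P, evalAt, Finsupp.sum, map_sum, Finset.sum_mul]
    refine Finset.sum_congr rfl fun a ha => ?_
    rw [mul_assoc, ← Finset.prod_mul_distrib, MvPolynomial.monomial_eq, map_mul]
    congr 1
    · simp
    · rw [Finsupp.prod_fintype _ _ (by simp), map_prod]
      refine Finset.prod_congr rfl fun i _ => ?_
      rw [← zpow_add₀ (RatFn.var_ne_zero i), map_pow, ← zpow_natCast]
      congr 1
      exact Int.toNat_of_nonneg (hb a ha i)
  have hP0 : P = 0 := by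
    apply IsFractionRing.injective (MvPolynomial ι ℚ) (RatFn ι)
    rw [hP, h0, zero_mul, map_zero]
  rw [← coeff_eq_zero]
  ext a
  by_contra ha
  have ha' : a ∈ q.coeff.support := by simpa using ha
  have : P.coeff (f a) = q.coeff a := by
    simp only [P, MvPolynomial.coeff_sum, MvPolynomial.coeff_monomial]
    rw [Finset.sum_eq_single a]
    · simp
    · intro a' ha'' hne
      rw [if_neg]
      intro h
      exact hne (hf ha'' ha' h)
    · intro h; exact absurd ha' h
  rw [hP0] at this
  apply ha
  simpa using this.symm

end LaurentPoly

/-! ### Well-definedness of transforms and specializations -/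

open LaurentPoly in
theorem IsSpecialization.unique {ι : Type} [Fintype ι] {K : Type} [Field K] {y : ι → K}
    (hy : ∀ i, y i ≠ 0) {Q : RatFn ι} {r r' : K} (h : IsSpecialization y Q r)
    (h' : IsSpecialization y Q r') : r = r' := by
  obtain ⟨p, q, hq, hQ, rfl⟩ := h
  obtain ⟨p', q', hq', hQ', rfl⟩ := h'
  have hv : ∀ i : ι, RatFn.var i ≠ 0 := RatFn.var_ne_zero
  have ne : ∀ {q : LaurentPoly ι}, q.evalAt y ≠ 0 → q.evalAt RatFn.var ≠ 0 := by
    intro q hq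
    apply evalAt_var_ne_zero
    rintro rfl
    exact hq (by simp [evalAt])
  rw [hQ, div_eq_div_iff (ne hq) (ne hq')] at hQ'
  rw [div_eq_div_iff hq hq']
  simp only [← evalHom_apply _ hy, ← evalHom_apply _ hv, ← map_mul] at hQ' ⊢
  congr 1
  rw [← sub_eq_zero]
  by_contra hne
  apply evalAt_var_ne_zero hne
  rw [← evalHom_apply _ hv, map_sub, hQ', sub_self]

open LaurentPoly in
theorem IsIntegerPointTransform.unique {ι : Type} [Fintype ι] {P : Set (ι → ℝ)} {Q Q' : RatFn ι}
    (h : IsIntegerPointTransform P Q) (h' : IsIntegerPointTransform P Q') : Q = Q' := by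
  obtain ⟨p, q, hq, hS, rfl⟩ := h
  obtain ⟨p', q', hq', hS', rfl⟩ := h'
  have hv : ∀ i : ι, RatFn.var i ≠ 0 := RatFn.var_ne_zero
  rw [div_eq_div_iff (evalAt_var_ne_zero hq) (evalAt_var_ne_zero hq')]
  simp only [← evalHom_apply _ hv, ← map_mul]
  congr 1
  apply AddMonoidAlgebra.coeff_injective
  apply DFunLike.coe_injective
  rw [mul_comm, mul_comm p', ← mulSeries_coeff, ← mulSeries_coeff, ← funext hS, ← funext hS',
    ← mul_mulSeries, ← mul_mulSeries, mul_comm]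

open LaurentPoly in
/-- If a multiple `q * S(P)` is a Laurent polynomial `p` and `q` does not vanish at `y`, then `σ(P)`
and its specialization at `y` are well defined and the latter is `p(y) / q(y)`. -/
theorem sigma_wellDefined {ι : Type} [Fintype ι] {K : Type} [Field K] {y : ι → K}
    {P : Set (ι → ℝ)} {p q : LaurentPoly ι} (hq : q.evalAt y ≠ 0)
    (hS : q.mulSeries (genSeries P) = p.coeff) :
    (∃! Q, IsIntegerPointTransform P Q) ∧
      IsSpecialization y (sigma P) (p.evalAt y / q.evalAt y) := by
  have hq0 : q ≠ 0 := by
    rintro rfl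
    exact hq (by simp [evalAt])
  have h1 : IsIntegerPointTransform P (p.evalAt RatFn.var / q.evalAt RatFn.var) :=
    ⟨p, q, hq0, congrFun hS, rfl⟩
  have hsig : sigma P = p.evalAt RatFn.var / q.evalAt RatFn.var := by
    have h : ∃ Q, IsIntegerPointTransform P Q := ⟨_, h1⟩
    rw [sigma, dif_pos h]
    exact h.choose_spec.unique h1
  exact ⟨⟨_, h1, fun Q hQ => hQ.unique h1⟩, p, q, hq, hsig, rfl⟩

theorem gtSubst_ne_zero (n : ℕ) (p : GTIndex n) : gtSubst n p ≠ 0 := by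
  unfold gtSubst
  split_ifs
  · exact RatFn.var_ne_zero _
  · exact mul_ne_zero (inv_ne_zero (RatFn.var_ne_zero _)) (RatFn.var_ne_zero _)

theorem specF_eq {n : ℕ} {Q : RatFn (GTIndex n)} {r : RatFn (Fin n)}
    (h : IsSpecialization (gtSubst n) Q r) : specF Q = r := by
  have h' : ∃ r, IsSpecialization (gtSubst n) Q r := ⟨_, h⟩
  rw [specF, dif_pos h']
  exact h'.choose_spec.unique (gtSubst_ne_zero n) h

/-! ### Linear independence of monomials -/

theorem sum_expWeight_ne_zero {n : ℕ} {κ : Type*} {s : Finset κ} {a : κ → Fin n → ℤ}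
    (ha : Set.InjOn a s) {c : κ → ℤ} {k : κ} (hk : k ∈ s) (hc : c k ≠ 0) :
    ∑ k ∈ s, (c k : RatFn (Fin n)) * expWeight (a k) ≠ 0 := by
  classical
  let q : LaurentPoly (Fin n) := ∑ k ∈ s, AddMonoidAlgebra.single (a k) (c k)
  have hq : q ≠ 0 := by
    intro h
    have h1 : q.coeff (a k) = c k := by
      simp only [q, AddMonoidAlgebra.coeff_sum, Finsupp.finsetSum_apply]
      rw [Finset.sum_eq_single k]
      · simp
      · intro k' hk' hne
        rw [AddMonoidAlgebra.coeff_single, Finsupp.single_apply, if_neg]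
        exact fun h => hne (ha hk' hk h)
      · exact fun h => absurd hk h
    rw [h] at h1
    exact hc (by simpa using h1.symm)
  have := LaurentPoly.evalAt_var_ne_zero hq
  rw [← LaurentPoly.evalHom_apply _ (fun i => RatFn.var_ne_zero i)] at this
  simpa [q, map_sum, LaurentPoly.evalHom_single, expWeight] using this

theorem expWeight_injective {n : ℕ} : Function.Injective (expWeight (n := n)) := by
  intro a b h
  by_contra hne
  have := sum_expWeight_ne_zero (s := Finset.univ) (a := fun t : Bool => if t then a else b)
    (c := fun t => if t then 1 else -1) (k := true)
    (by intro x _ y _; cases x <;> cases y <;> simp [hne, Ne.symm hne]) (by simp) (by simp)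
  simp [h] at this

/-! ### Weighted totals of graded families of series -/

section Totals

variable {ι : Type} {N : ℕ}

/-- The formal sum `∑ z, ω z • f z` of a family of series such that `f z` is supported on
`r ⁻¹ {z}`: the coefficient of the sum at `A` only involves `z = r A`. -/
def weightedTotal (r : (ι → ℤ) →+ (Fin N → ℤ)) (ω : (Fin N → ℤ) → ℤ)
    (f : (Fin N → ℤ) → (ι → ℤ) → ℤ) : (ι → ℤ) → ℤ :=
  fun A => ω (r A) * f (r A) A

theorem mulSeries_weightedTotal {r : (ι → ℤ) →+ (Fin N → ℤ)} (ω : (Fin N → ℤ) → ℤ)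
    {f : (Fin N → ℤ) → (ι → ℤ) → ℤ} (hf : ∀ z A, f z A ≠ 0 → r A = z) (q : LaurentPoly ι)
    (A : ι → ℤ) {Z : Finset (Fin N → ℤ)} (hZ : ∀ b ∈ q.coeff.support, r (A - b) ∈ Z) :
    q.mulSeries (weightedTotal r ω f) A = ∑ z ∈ Z, ω z * q.mulSeries (f z) A := by
  simp only [LaurentPoly.mulSeries_eq_sum, weightedTotal, Finset.mul_sum]
  rw [Finset.sum_comm]
  refine Finset.sum_congr rfl fun b hb => ?_
  rw [Finset.sum_eq_single_of_mem _ (hZ b hb)]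
  · ring
  · intro z _ hz
    have : f z (A - b) = 0 := by
      by_contra h
      exact hz (hf _ _ h).symm
    simp [this]

/-- A relation with Laurent polynomial coefficients between graded families passes to their
weighted totals. -/
theorem mulSeries_weightedTotal_eq_sum {r : (ι → ℤ) →+ (Fin N → ℤ)} (ω : (Fin N → ℤ) → ℤ)
    {f : (Fin N → ℤ) → (ι → ℤ) → ℤ} (hf : ∀ z A, f z A ≠ 0 → r A = z) {q : LaurentPoly ι}
    {κ : Type*} [Fintype κ] {p : κ → LaurentPoly ι} {h : κ → (Fin N → ℤ) → (ι → ℤ) → ℤ}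
    (hh : ∀ k z A, h k z A ≠ 0 → r A = z)
    (hq : ∀ z, q.mulSeries (f z) = ∑ k, (p k).mulSeries (h k z)) :
    q.mulSeries (weightedTotal r ω f) = ∑ k, (p k).mulSeries (weightedTotal r ω (h k)) := by
  classical
  ext A
  let Z : Finset (Fin N → ℤ) := q.coeff.support.image (fun b => r (A - b)) ∪
    Finset.univ.biUnion fun k => (p k).coeff.support.image fun b => r (A - b)
  rw [mulSeries_weightedTotal ω hf q A (Z := Z), Finset.sum_apply]
  · rw [Finset.sum_congr rfl fun k _ => mulSeries_weightedTotal ω (hh k) (p k) A (Z := Z) ?_]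
    · rw [Finset.sum_comm]
      refine Finset.sum_congr rfl fun z _ => ?_
      rw [hq, Finset.sum_apply, Finset.mul_sum]
    · intro b hb
      exact Finset.mem_union_right _ (Finset.mem_biUnion.2
        ⟨k, Finset.mem_univ _, Finset.mem_image_of_mem _ hb⟩)
  · intro b hb
    exact Finset.mem_union_left _ (Finset.mem_image_of_mem _ hb)

/-! ### Series supported on a lattice -/

open Classical in
/-- The series `∑ z, (∏ j, ψ j (z j)) t ^ (∑ j, z j • T j)`, when `r` is a left inverse of
`z ↦ ∑ j, z j • T j`. -/
noncomputable def latticeSeries (r : (ι → ℤ) →+ (Fin N → ℤ)) (T : Fin N → ι → ℤ)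
    (ψ : Fin N → ℤ → ℤ) : (ι → ℤ) → ℤ :=
  fun A => if A = ∑ j, r A j • T j then ∏ j, ψ j (r A j) else 0

variable {r : (ι → ℤ) →+ (Fin N → ℤ)} {T : Fin N → ι → ℤ}

theorem map_sum_smul_of_dual (hT : ∀ j, r (T j) = Pi.single j 1) (z : Fin N → ℤ) :
    r (∑ j, z j • T j) = z := by
  ext k
  simp only [map_sum, map_zsmul, hT]
  simp [Pi.single_apply]

theorem latticeSeries_shift (hT : ∀ j, r (T j) = Pi.single j 1) (ψ : Fin N → ℤ → ℤ) (j : Fin N)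
    (c : ℤ) (A : ι → ℤ) :
    latticeSeries r T ψ (A - c • T j) =
      latticeSeries r T (Function.update ψ j fun z => ψ j (z - c)) A := by
  classical
  have hr : r (A - c • T j) = r A - Pi.single j c := by
    rw [map_sub, map_zsmul, hT, ← Pi.single_smul]
    simp
  have hc : (A - c • T j = ∑ k, r (A - c • T j) k • T k) ↔ A = ∑ k, r A k • T k := by
    have : ∑ k, r (A - c • T j) k • T k = ∑ k, r A k • T k - c • T j := by
      rw [hr]
      simp [sub_smul, Finset.sum_sub_distrib, Pi.single_apply, ite_smul]
    rw [this, sub_left_inj]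
  unfold latticeSeries
  simp only [hc]
  split_ifs
  · refine Finset.prod_congr rfl fun k _ => ?_
    rw [hr]
    by_cases hk : k = j
    · subst hk; simp
    · simp [hk]
  · rfl

theorem latticeSeries_update (ψ : Fin N → ℤ → ℤ) (j : Fin N) (g : ℤ → ℤ) (A : ι → ℤ) :
    latticeSeries r T (Function.update ψ j g) A =
      g (r A j) * latticeSeries r T (Function.update ψ j 1) A := by
  classical
  unfold latticeSeries
  split_ifs
  · rw [← Finset.mul_prod_erase _ _ (Finset.mem_univ j),
      ← Finset.mul_prod_erase (a := j) (s := Finset.univ)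
        (f := fun k => Function.update ψ j (1 : ℤ → ℤ) k (r A k)) (Finset.mem_univ j)]
    simp only [Function.update_self, Pi.one_apply, one_mul]
    congr 1
    refine Finset.prod_congr rfl fun k hk => ?_
    simp [Finset.ne_of_mem_erase hk]
  · simp

/-- Summing a weight with finitely supported difference along one lattice direction is a geometric
summation. -/
theorem geometric_mulSeries_latticeSeries (hT : ∀ j, r (T j) = Pi.single j 1)
    (ψ : Fin N → ℤ → ℤ) (j : Fin N) {l u a b : ℤ}
    (hψ : ∀ z, ψ j z - ψ j (z - 1) = (if z = a then l else 0) - (if z = b + 1 then u else 0)) :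
    (1 - AddMonoidAlgebra.single (T j) 1 : LaurentPoly ι).mulSeries (latticeSeries r T ψ) =
      LaurentPoly.mulSeries
        (AddMonoidAlgebra.single (a • T j) l - AddMonoidAlgebra.single ((b + 1) • T j) u)
        (latticeSeries r T (Function.update ψ j fun z => if z = 0 then 1 else 0)) := by
  ext A
  rw [LaurentPoly.sub_mulSeries, LaurentPoly.sub_mulSeries, LaurentPoly.one_mulSeries]
  simp only [Pi.sub_apply, LaurentPoly.single_mulSeries, latticeSeries_shift hT]
  have h1 := latticeSeries_shift hT ψ j 1 A
  rw [one_smul] at h1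
  rw [h1]
  conv_lhs => rw [← Function.update_eq_self j ψ]
  simp only [Function.update_idem, Function.update_self]
  rw [latticeSeries_update ψ j (ψ j), latticeSeries_update ψ j (fun z => ψ j (z - 1)),
    latticeSeries_update ψ j (fun z => if z - a = 0 then 1 else 0),
    latticeSeries_update ψ j (fun z => if z - (b + 1) = 0 then 1 else 0)]
  have := hψ (r A j)
  simp only [one_mul, sub_eq_zero] at this ⊢
  rw [← sub_mul, this, sub_mul, ← mul_assoc, ← mul_assoc]
  simp

/-- The box sum: the product of all geometric summations. -/
theorem prod_mulSeries_latticeSeries (hT : ∀ j, r (T j) = Pi.single j 1)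
    (ψ : Fin N → ℤ → ℤ) {l u a b : Fin N → ℤ}
    (hψ : ∀ j z, ψ j z - ψ j (z - 1) =
      (if z = a j then l j else 0) - (if z = b j + 1 then u j else 0)) :
    (∏ j, (1 - AddMonoidAlgebra.single (T j) 1) : LaurentPoly ι).mulSeries (latticeSeries r T ψ) =
      (∏ j, (AddMonoidAlgebra.single (a j • T j) (l j) -
        AddMonoidAlgebra.single ((b j + 1) • T j) (u j)) : LaurentPoly ι).coeff := by
  classical
  have key : ∀ J : Finset (Fin N),
      (∏ j ∈ J, (1 - AddMonoidAlgebra.single (T j) 1) : LaurentPoly ι).mulSeries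
        (latticeSeries r T ψ) =
      (∏ j ∈ J, (AddMonoidAlgebra.single (a j • T j) (l j) -
        AddMonoidAlgebra.single ((b j + 1) • T j) (u j)) : LaurentPoly ι).mulSeries
        (latticeSeries r T fun j => if j ∈ J then (fun z => if z = 0 then 1 else 0) else ψ j) := by
    intro J
    induction J using Finset.induction_on with
    | empty => simp
    | insert j J hj ih =>
      rw [Finset.prod_insert hj, Finset.prod_insert hj, LaurentPoly.mul_mulSeries, ih,
        ← LaurentPoly.mul_mulSeries, mul_comm, LaurentPoly.mul_mulSeries,
        geometric_mulSeries_latticeSeries hT _ j (l := l j) (u := u j) (a := a j) (b := b j),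
        ← LaurentPoly.mul_mulSeries, mul_comm]
      · congr 2
        ext k z
        by_cases hk : k = j
        · subst hk; simp
        · simp [hk]
      · intro z
        simpa [hj] using hψ j z
  rw [key Finset.univ, ← mul_one (∏ j, (AddMonoidAlgebra.single (a j • T j) (l j) -
    AddMonoidAlgebra.single ((b j + 1) • T j) (u j)) : LaurentPoly ι),
    ← LaurentPoly.mulSeries_coeff, mul_one]
  congr 1
  ext A
  rw [AddMonoidAlgebra.one_def, AddMonoidAlgebra.coeff_single, Finsupp.single_apply]
  simp only [latticeSeries, Finset.mem_univ, if_true]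
  by_cases hA : A = 0
  · subst hA
    simp
  · rw [if_neg (Ne.symm hA)]
    split_ifs with h
    · obtain ⟨j, hj⟩ : ∃ j, r A j ≠ 0 := by
        by_contra! h'
        apply hA
        rw [h]
        simp [h']
      exact Finset.prod_eq_zero (Finset.mem_univ j) (by simp [hj])
    · rfl

theorem weightedTotal_single (ψ : Fin N → ℤ → ℤ) :
    weightedTotal r (fun z => ∏ j, ψ j (z j))
      (fun z => (AddMonoidAlgebra.single (∑ j, z j • T j) 1 : LaurentPoly ι).coeff) =
      latticeSeries r T ψ := by
  classical
  ext A
  simp only [weightedTotal, latticeSeries, AddMonoidAlgebra.coeff_single, Finsupp.single_apply]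
  simp [eq_comm]

end Totals

/-! ### Independence of characters -/

/-- If two linear combinations of characters of `ℤ ^ N` agree, then so do the combinations with the
same coefficients of any other quantity attached to the characters. -/
theorem sum_congr_of_sum_characters {K : Type*} [Field K] {N : ℕ} {κ κ' : Type*} [Fintype κ]
    [Fintype κ'] {c : κ → K} {c' : κ' → K} {w : κ → Fin N → K} {w' : κ' → Fin N → K}
    (hw : ∀ k j, w k j ≠ 0) (hw' : ∀ k j, w' k j ≠ 0)
    (h : ∀ z : Fin N → ℤ, ∑ k, c k * ∏ j, w k j ^ z j = ∑ k, c' k * ∏ j, w' k j ^ z j)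
    (Φ : (Fin N → K) → K) : ∑ k, c k * Φ (w k) = ∑ k, c' k * Φ (w' k) := by
  classical
  let χ : (Fin N → Kˣ) → (Multiplicative (Fin N → ℤ) →* K) := fun w =>
    { toFun := fun z => ∏ j, (w j : K) ^ (Multiplicative.toAdd z j)
      map_one' := by simp
      map_mul' := fun a b => by
        simp [zpow_add₀, Finset.prod_mul_distrib] }
  have hχ : Function.Injective χ := by
    intro w w' hww
    ext j
    have := DFunLike.congr_fun hww (Multiplicative.ofAdd (Pi.single j 1))
    have e : ∀ w : Fin N → Kˣ, χ w (Multiplicative.ofAdd (Pi.single j 1)) = w j := by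
      intro w
      simp only [χ, MonoidHom.coe_mk, OneHom.coe_mk, toAdd_ofAdd]
      rw [Finset.prod_eq_single j]
      · simp
      · intro k _ hk
        simp [hk]
      · simp
    rwa [e, e] at this
  have hli : LinearIndependent K fun w : Fin N → Kˣ => (χ w : Multiplicative (Fin N → ℤ) → K) :=
    (linearIndependent_monoidHom (Multiplicative (Fin N → ℤ)) K).comp χ hχ
  let W : κ → Fin N → Kˣ := fun k j => Units.mk0 _ (hw k j)
  let W' : κ' → Fin N → Kˣ := fun k j => Units.mk0 _ (hw' k j)
  have hF : ∑ k, Finsupp.single (W k) (c k) = ∑ k, Finsupp.single (W' k) (c' k) := by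
    apply hli
    ext z
    simp only [map_sum, Finsupp.linearCombination_single, Finset.sum_apply, Pi.smul_apply,
      smul_eq_mul]
    exact h (Multiplicative.toAdd z)
  have := congrArg (Finsupp.linearCombination K fun w : Fin N → Kˣ => Φ fun j => w j) hF
  simpa [map_sum, Finsupp.linearCombination_single, W, W'] using this

/-! ### Entries, rows and monomials of triangles -/

section Triangles

variable {n : ℕ}

/-- The entry of a triangle at row `i` and place `j`, and `0` outside the triangle. -/
def entry {α : Type*} [Zero α] (A : GTIndex n → α) (i j : ℕ) : α :=
  if h : i + j < n then A (GTIndex.mk i j h) else 0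

/-- The place of a position in its row. -/
def GTIndex.col (p : GTIndex n) : Fin n := p.1.2

@[simp] theorem GTIndex.row_mk (i j : ℕ) (h : i + j < n) :
    ((GTIndex.mk i j h).row : ℕ) = i := rfl

@[simp] theorem GTIndex.col_mk (i j : ℕ) (h : i + j < n) :
    ((GTIndex.mk i j h).col : ℕ) = j := rfl

theorem GTIndex.row_add_col (p : GTIndex n) : (p.row : ℕ) + (p.col : ℕ) < n := p.2

theorem GTIndex.ext_iff' {p q : GTIndex n} :
    p = q ↔ (p.row : ℕ) = q.row ∧ (p.col : ℕ) = q.col := by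
  constructor
  · rintro rfl; simp
  · rintro ⟨h1, h2⟩
    exact Subtype.ext (Prod.ext (Fin.ext h1) (Fin.ext h2))

theorem entry_of_lt {α : Type*} [Zero α] (A : GTIndex n → α) {i j : ℕ} (h : i + j < n) :
    entry A i j = A (GTIndex.mk i j h) := dif_pos h

theorem entry_row_col {α : Type*} [Zero α] (A : GTIndex n → α) (p : GTIndex n) :
    entry A p.row p.col = A p := entry_of_lt A p.row_add_col

theorem filter_row_eq {i N : ℕ} (hi : i + N = n) :
    (Finset.univ.filter fun p : GTIndex n => (p.row : ℕ) = i) =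
      Finset.univ.image fun j : Fin N => GTIndex.mk i j (by omega) := by
  ext p
  simp only [Finset.mem_filter, Finset.mem_univ, true_and, Finset.mem_image]
  constructor
  · intro h
    have := p.row_add_col
    exact ⟨⟨p.col, by omega⟩, GTIndex.ext_iff'.2 ⟨h.symm, rfl⟩⟩
  · rintro ⟨j, rfl⟩
    rfl

theorem mk_injective {i N : ℕ} (hi : i + N = n) :
    Function.Injective fun j : Fin N => (GTIndex.mk i j (by omega) : GTIndex n) := by
  intro j j' h
  exact Fin.ext (GTIndex.ext_iff'.1 h).2

theorem prod_row {M : Type*} [CommMonoid M] {i N : ℕ} (hi : i + N = n) (f : GTIndex n → M) :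
    ∏ p : GTIndex n with (p.row : ℕ) = i, f p =
      ∏ j : Fin N, f (GTIndex.mk i j (by omega)) := by
  rw [filter_row_eq hi, Finset.prod_image (by intro a _ b _ h; exact mk_injective hi h)]

theorem sum_row {M : Type*} [AddCommMonoid M] {i N : ℕ} (hi : i + N = n) (f : GTIndex n → M) :
    ∑ p : GTIndex n with (p.row : ℕ) = i, f p =
      ∑ j : Fin N, f (GTIndex.mk i j (by omega)) := by
  rw [filter_row_eq hi, Finset.sum_image (by intro a _ b _ h; exact mk_injective hi h)]

/-- The triangle with a single `1` in row `i` at place `j`. -/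
def unitTriangle (n i j : ℕ) : GTIndex n → ℤ :=
  fun p => if (p.row : ℕ) = i ∧ (p.col : ℕ) = j then 1 else 0

/-- Row `i` of a triangle, as an additive map. -/
def rowHom (n i N : ℕ) : (GTIndex n → ℤ) →+ (Fin N → ℤ) where
  toFun A j := entry A i j
  map_zero' := by ext j; simp [entry]
  map_add' A B := by
    ext j
    simp only [entry, Pi.add_apply]
    split_ifs <;> simp

theorem rowHom_apply {i N : ℕ} (A : GTIndex n → ℤ) (j : Fin N) :
    rowHom n i N A j = entry A i j := rfl

theorem sum_smul_unitTriangle {i N : ℕ} (hi : i + N = n) (y : Fin N → ℤ) (p : GTIndex n) :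
    (∑ j, y j • unitTriangle n i j) p =
      if h : (p.row : ℕ) = i then y ⟨p.col, by have := p.row_add_col; omega⟩ else 0 := by
  simp only [Finset.sum_apply, Pi.smul_apply, unitTriangle, smul_eq_mul]
  split_ifs with h
  · have := p.row_add_col
    rw [Finset.sum_eq_single ⟨p.col, by omega⟩]
    · simp [h]
    · intro b _ hb
      have : ¬ ((p.col : ℕ) = b) := fun h' => hb (Fin.ext h'.symm)
      simp [this]
    · simp
  · simp [h]

theorem expWeight_zero : expWeight (0 : Fin n → ℤ) = 1 := by simp [expWeight]

theorem expWeight_add (a b : Fin n → ℤ) : expWeight (a + b) = expWeight a * expWeight b := by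
  simp [expWeight, zpow_add₀ (RatFn.var_ne_zero _), Finset.prod_mul_distrib]

theorem expWeight_sum {κ : Type*} (s : Finset κ) (a : κ → Fin n → ℤ) :
    expWeight (∑ k ∈ s, a k) = ∏ k ∈ s, expWeight (a k) := by
  classical
  induction s using Finset.induction_on with
  | empty => simp [expWeight_zero]
  | insert k s hk ih => rw [Finset.sum_insert hk, Finset.prod_insert hk, expWeight_add, ih]

theorem expWeight_smul (c : ℤ) (a : Fin n → ℤ) : expWeight (c • a) = expWeight a ^ c := by
  simp [expWeight, ← Finset.prod_zpow, zpow_mul, mul_comm c]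

theorem expWeight_single (i : Fin n) (c : ℤ) : expWeight (Pi.single i c) = RatFn.var i ^ c := by
  unfold expWeight
  rw [Finset.prod_eq_single i]
  · simp
  · intro k _ hk
    simp [hk]
  · simp

/-- The specialization sends the monomial of a triangle to the monomial of its weight. -/
theorem prod_gtSubst_zpow (T : GTIndex n → ℤ) :
    ∏ p, gtSubst n p ^ T p = expWeight fun i : Fin n =>
      ∑ p : GTIndex n with (p.row : ℕ) = i, T p -
        ∑ p : GTIndex n with (p.row : ℕ) = (i : ℕ) + 1, T p := by
  let W : GTIndex n → Fin n → ℤ := fun p i =>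
    (if (p.row : ℕ) = i then 1 else 0) - (if (p.row : ℕ) = (i : ℕ) + 1 then 1 else 0)
  have hW : ∀ p, gtSubst n p = expWeight (W p) := by
    intro p
    unfold gtSubst
    split_ifs with h
    · have : W p = Pi.single p.row 1 := by
        ext i
        simp only [W, Pi.single_apply, Fin.ext_iff]
        split_ifs <;> omega
      rw [this, expWeight_single, zpow_one]
    · have : W p = Pi.single ⟨(p.row : ℕ) - 1, by omega⟩ (-1) + Pi.single p.row 1 := by
        ext i
        simp only [W, Pi.add_apply, Pi.single_apply, Fin.ext_iff]
        split_ifs <;> omega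
      rw [this, expWeight_add, expWeight_single, expWeight_single, zpow_neg_one, zpow_one]
  simp only [hW, ← expWeight_smul]
  rw [← expWeight_sum]
  congr 1
  ext i
  simp only [Finset.sum_apply, Pi.smul_apply, W, smul_eq_mul, mul_sub, Finset.sum_sub_distrib,
    mul_ite, mul_one, mul_zero, Finset.sum_filter]

/-- Evaluation of Laurent polynomials at the specialization. -/
noncomputable abbrev specHom (n : ℕ) : LaurentPoly (GTIndex n) →+* RatFn (Fin n) :=
  LaurentPoly.evalHom (gtSubst n) (gtSubst_ne_zero n)

theorem specHom_single_smul (T : GTIndex n → ℤ) (c u : ℤ) :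
    specHom n (AddMonoidAlgebra.single (c • T) u) =
      u * specHom n (AddMonoidAlgebra.single T 1) ^ c := by
  simp [LaurentPoly.evalHom_single, ← Finset.prod_zpow, zpow_mul, mul_comm c]

theorem specHom_single_sum {κ : Type*} (s : Finset κ) (T : κ → GTIndex n → ℤ) :
    specHom n (AddMonoidAlgebra.single (∑ k ∈ s, T k) 1) =
      ∏ k ∈ s, specHom n (AddMonoidAlgebra.single (T k) 1) := by
  rw [← map_prod, AddMonoidAlgebra.prod_single]
  simp

theorem specHom_single_ne_zero (T : GTIndex n → ℤ) :
    specHom n (AddMonoidAlgebra.single T 1) ≠ 0 := by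
  simp [LaurentPoly.evalHom_single, Finset.prod_ne_zero_iff, zpow_ne_zero, gtSubst_ne_zero]

/-- A monomial whose first nonzero row is row `i + 1`, with sum `1`, does not specialize to `1`:
the variable `x_i` occurs in it with exponent `-1`. -/
theorem specHom_single_ne_one {i : ℕ} (hi : i < n) {T : GTIndex n → ℤ}
    (h0 : ∀ p : GTIndex n, (p.row : ℕ) ≤ i → T p = 0)
    (h1 : ∑ p : GTIndex n with (p.row : ℕ) = i + 1, T p = 1) :
    specHom n (AddMonoidAlgebra.single T 1) ≠ 1 := by
  rw [LaurentPoly.evalHom_single, prod_gtSubst_zpow, Int.cast_one, one_mul, ← expWeight_zero]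
  intro h
  have := congrFun (expWeight_injective h) ⟨i, hi⟩
  simp only [h1, Pi.zero_apply] at this
  rw [Finset.sum_eq_zero] at this
  · omega
  · intro p hp
    exact h0 p (Finset.mem_filter.1 hp).2.le

end Triangles

/-! ### Signed series of triangles with a given top row -/

section SignedSeries

open Classical in
/-- The signed indicator of the interval of `z` with `z ≤ b` (imposed if `u`) and `a ≤ z` (imposed
if `l`). If both bounds are imposed and `b < a - 1`, the integers strictly between `b` and `a` count
with sign `-1`. -/
noncomputable def intervalWeight (u l : Prop) (b a z : ℤ) : ℤ :=
  if u then (if z ≤ b then 1 else 0) - (if l ∧ z < a then 1 else 0)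
  else if l ∧ z < a then 0 else 1

open Classical in
theorem intervalWeight_sub (u l : Prop) (b a z : ℤ) :
    intervalWeight u l b a z - intervalWeight u l b a (z - 1) =
      (if z = a then (if l then 1 else 0) else 0) -
        (if z = b + 1 then (if u then 1 else 0) else 0) := by
  unfold intervalWeight
  by_cases hu : u <;> by_cases hl : l <;> simp only [hu, hl, true_and, false_and, if_true, if_false]
    <;> split_ifs <;> omega

variable {n : ℕ}

/-- The weight of the entry at `p` of a triangle `A`, given its two upper neighbours: only those
inequalities are imposed that are equalities for `v`. -/
noncomputable def entryWeight (v : GTIndex n → ℝ) (A : GTIndex n → ℤ) (p : GTIndex n) : ℤ :=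
  intervalWeight (entry v ((p.row : ℕ) - 1) p.col = v p)
    (entry v ((p.row : ℕ) - 1) ((p.col : ℕ) + 1) = v p)
    (entry A ((p.row : ℕ) - 1) p.col) (entry A ((p.row : ℕ) - 1) ((p.col : ℕ) + 1)) (A p)

open Classical in
/-- The signed series of the triangles which vanish above row `i`, have row `i` equal to `y`, and
satisfy below row `i` the inequalities that are equalities for `v`. -/
noncomputable def signedSeries (v : GTIndex n → ℝ) (i N : ℕ) (y : Fin N → ℤ) :
    (GTIndex n → ℤ) → ℤ :=
  fun A => if (∀ p : GTIndex n, (p.row : ℕ) < i → A p = 0) ∧ rowHom n i N A = y then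
    ∏ p : GTIndex n with i < (p.row : ℕ), entryWeight v A p else 0

theorem rowHom_of_signedSeries_ne_zero {v : GTIndex n → ℝ} {i N : ℕ} {y : Fin N → ℤ}
    {A : GTIndex n → ℤ} (h : signedSeries v i N y A ≠ 0) : rowHom n i N A = y := by
  unfold signedSeries at h
  by_contra h'
  rw [if_neg (fun h'' => h' h''.2)] at h
  exact h rfl

theorem signedSeries_succ (v : GTIndex n → ℝ) {i N : ℕ} (hi : i + (N + 1) = n)
    (y : Fin (N + 1) → ℤ) :
    signedSeries v i (N + 1) y =
      LaurentPoly.mulSeries (AddMonoidAlgebra.single (∑ j, y j • unitTriangle n i j) 1)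
        (weightedTotal (rowHom n (i + 1) N)
          (fun z => ∏ j : Fin N, intervalWeight (entry v i j = entry v (i + 1) j)
            (entry v i (j + 1) = entry v (i + 1) j) (y j.castSucc) (y j.succ) (z j))
          (signedSeries v (i + 1) N)) := by
  classical
  ext A
  rw [LaurentPoly.single_mulSeries, one_mul]
  set Y := ∑ j, y j • unitTriangle n i j with hYdef
  have hY : ∀ p : GTIndex n, (p.row : ℕ) ≠ i → (A - Y) p = A p := by
    intro p hp
    rw [Pi.sub_apply, hYdef, sum_smul_unitTriangle hi, dif_neg hp, sub_zero]
  have hentry : ∀ i' j : ℕ, i' ≠ i → entry (A - Y) i' j = entry A i' j := by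
    intro i' j hi'
    unfold entry
    split_ifs with h
    · exact hY _ hi'
    · rfl
  have hcond : ((∀ p : GTIndex n, (p.row : ℕ) < i → A p = 0) ∧ rowHom n i (N + 1) A = y) ↔
      ∀ p : GTIndex n, (p.row : ℕ) < i + 1 → (A - Y) p = 0 := by
    constructor
    · rintro ⟨h1, h2⟩ p hp
      by_cases hpi : (p.row : ℕ) = i
      · rw [Pi.sub_apply, hYdef, sum_smul_unitTriangle hi, dif_pos hpi, ← h2, rowHom_apply]
        have h3 := entry_row_col A p
        rw [hpi] at h3
        exact sub_eq_zero.2 h3.symm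
      · rw [hY p hpi]
        exact h1 p (by omega)
    · intro h
      constructor
      · intro p hp
        rw [← hY p (by omega)]
        exact h p (by omega)
      · ext j
        have hj : i + (j : ℕ) < n := by omega
        have := h (GTIndex.mk i j hj) (by simp)
        rw [Pi.sub_apply, hYdef, sum_smul_unitTriangle hi, dif_pos (GTIndex.row_mk i j hj),
          sub_eq_zero] at this
        rw [rowHom_apply, entry_of_lt A hj, this]
        rfl
  unfold signedSeries weightedTotal
  simp only [hcond]
  by_cases hc : ∀ p : GTIndex n, (p.row : ℕ) < i + 1 → (A - Y) p = 0
  · rw [if_pos hc, if_pos ⟨hc, trivial⟩]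
    have hrow : rowHom n i (N + 1) A = y := (hcond.2 hc).2
    have hsplit : (Finset.univ.filter fun p : GTIndex n => i < (p.row : ℕ)) =
        (Finset.univ.filter fun p : GTIndex n => (p.row : ℕ) = i + 1) ∪
        (Finset.univ.filter fun p : GTIndex n => i + 1 < (p.row : ℕ)) := by
      ext p
      simp only [Finset.mem_filter, Finset.mem_union, Finset.mem_univ, true_and]
      omega
    rw [hsplit, Finset.prod_union, prod_row (i := i + 1) (N := N) (by omega)]
    · congr 1
      · refine Finset.prod_congr rfl fun j _ => ?_
        have hj : i + 1 + (j : ℕ) < n := by omega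
        unfold entryWeight
        simp only [GTIndex.row_mk, GTIndex.col_mk, Nat.add_sub_cancel, rowHom_apply]
        rw [hentry _ _ (by omega), ← hrow, rowHom_apply, rowHom_apply, entry_of_lt v hj,
          entry_of_lt A hj]
        rfl
      · refine Finset.prod_congr rfl fun p hp => ?_
        have hp' := (Finset.mem_filter.1 hp).2
        unfold entryWeight
        rw [hentry _ _ (by omega), hentry _ _ (by omega), hY p (by omega)]
    · rw [Finset.disjoint_filter]
      intro p _ h
      omega
  · rw [if_neg hc, if_neg (fun h => hc h.1), mul_zero]

end SignedSeries

/-! ### Values of signed series -/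

section RowValue

variable {n : ℕ}

open AddMonoidAlgebra in
/-- The series of triangles with row `i` equal to `y` have the values `V y` under the
specialization: a common multiple of them is, uniformly in `y`, a combination of monomials whose
exponents are linear in `y`. -/
def HasRowValue (v : GTIndex n → ℝ) (i N : ℕ) (V : (Fin N → ℤ) → RatFn (Fin n)) : Prop :=
  ∃ (q : LaurentPoly (GTIndex n)) (κ : Type) (_ : Fintype κ) (p : κ → LaurentPoly (GTIndex n))
    (T : κ → Fin N → GTIndex n → ℤ),
    (∀ k j (P : GTIndex n), (P.row : ℕ) ≤ i → T k j P = 0) ∧ specHom n q ≠ 0 ∧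
    ∀ y : Fin N → ℤ,
      q.mulSeries (signedSeries v i N y) =
        (∑ k, p k * single (∑ j, y j • (unitTriangle n i j + T k j)) 1).coeff ∧
      specHom n (∑ k, p k * single (∑ j, y j • (unitTriangle n i j + T k j)) 1) =
        specHom n q * V y

open AddMonoidAlgebra in
/-- Expansion of a product of differences of monomials whose exponents involve neighbouring
coordinates of `y`, as a combination of monomials with exponents linear in `y`. -/
theorem prod_single_sub_single_eq_sum {ι : Type} {N : ℕ} (T : Fin N → ι → ℤ) (l u : Fin N → ℤ)
    (y : Fin (N + 1) → ℤ) :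
    (∏ j, (single (y j.succ • T j) (l j) - single ((y j.castSucc + 1) • T j) (u j))
      : LaurentPoly ι) =
    ∑ f : Fin N → Bool,
      single (∑ j, if f j then 0 else T j) (∏ j, if f j then l j else -u j) *
        single (∑ j', y j' • ∑ j, if (if f j then j.succ else j.castSucc) = j' then T j else 0)
          1 := by
  classical
  have h : ∀ j : Fin N, (single (y j.succ • T j) (l j) - single ((y j.castSucc + 1) • T j) (u j)
      : LaurentPoly ι) = ∑ b : Bool,
        single ((y (if b then j.succ else j.castSucc)) • T j + if b then 0 else T j)
          (if b then l j else -u j) := by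
    intro j
    rw [Fintype.sum_bool]
    simp [add_smul, sub_eq_add_neg, single_neg]
  simp only [h]
  rw [Finset.prod_univ_sum, Fintype.piFinset_univ]
  refine Finset.sum_congr rfl fun f _ => ?_
  rw [prod_single, single_mul_single, mul_one]
  congr 1
  rw [Finset.sum_add_distrib, add_comm]
  congr 1
  simp only [Finset.smul_sum, smul_ite, smul_zero]
  rw [Finset.sum_comm]
  simp

/-- The value of a sum over the next row, attached to a character of that row. -/
noncomputable def rowKernel {K : Type*} [Field K] {N : ℕ} (l u : Fin N → ℤ) (y : Fin (N + 1) → ℤ)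
    (w : Fin N → K) : K :=
  ∏ j, ((l j : K) * w j ^ y j.succ - u j * w j ^ (y j.castSucc + 1)) / (1 - w j)

open Classical in
/-- `1` if the entry at row `i + 1`, place `j` of `v` equals its left upper neighbour, else `0`. -/
noncomputable def leftTight (v : GTIndex n → ℝ) (i j : ℕ) : ℤ :=
  if entry v i j = entry v (i + 1) j then 1 else 0

open Classical in
/-- `1` if the entry at row `i + 1`, place `j` of `v` equals its right upper neighbour, else `0`. -/
noncomputable def rightTight (v : GTIndex n → ℝ) (i j : ℕ) : ℤ :=
  if entry v i (j + 1) = entry v (i + 1) j then 1 else 0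

theorem rowHom_unitTriangle_add {i N : ℕ} (hi : i + N = n) {T : GTIndex n → ℤ}
    (hT : ∀ P : GTIndex n, (P.row : ℕ) ≤ i → T P = 0) (j : Fin N) :
    rowHom n i N (unitTriangle n i j + T) = Pi.single j 1 := by
  ext k
  have hk : i + (k : ℕ) < n := by omega
  rw [rowHom_apply, entry_of_lt _ hk, Pi.add_apply, hT _ (by simp), add_zero, Pi.single_apply]
  simp [unitTriangle, Fin.ext_iff]

theorem specHom_unitTriangle_add_ne_one {i N : ℕ} (hi : i + 1 + N = n) {T : GTIndex n → ℤ}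
    (hT : ∀ P : GTIndex n, (P.row : ℕ) ≤ i + 1 → T P = 0) (j : Fin N) :
    specHom n (AddMonoidAlgebra.single (unitTriangle n (i + 1) j + T) 1) ≠ 1 := by
  apply specHom_single_ne_one (i := i) (by omega)
  · intro p hp
    rw [Pi.add_apply, hT p (by omega), unitTriangle, if_neg (by omega), add_zero]
  · rw [sum_row hi, Finset.sum_eq_single j]
    · rw [Pi.add_apply, hT _ (by simp)]
      simp [unitTriangle]
    · intro b _ hb
      rw [Pi.add_apply, hT _ (by simp)]
      simp [unitTriangle, Fin.val_inj, hb]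
    · simp

open AddMonoidAlgebra in
/-- Passage from row `i + 1` to row `i`: if the values for row `i + 1` are written as a combination
of characters, the sum over all rows `i + 1` below a given row `i` replaces each character by the
corresponding product of geometric sums. -/
theorem HasRowValue.step {v : GTIndex n → ℝ} {i N : ℕ} (hi : i + (N + 1) = n)
    {V : (Fin N → ℤ) → RatFn (Fin n)} (hV : HasRowValue v (i + 1) N V)
    {κ' : Type*} [Fintype κ'] {c : κ' → RatFn (Fin n)} {w : κ' → Fin N → RatFn (Fin n)}
    (hw : ∀ k j, w k j ≠ 0) (hVw : ∀ z, V z = ∑ k, c k * ∏ j, w k j ^ z j) :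
    HasRowValue v i (N + 1) fun y =>
      (∏ j : Fin (N + 1), specHom n (single (unitTriangle n i j) 1) ^ y j) *
        ∑ k, c k * rowKernel (fun j => rightTight v i j) (fun j => leftTight v i j) y (w k) := by
  classical
  obtain ⟨q, κ, _, p, T, hT, hq, h⟩ := hV
  set l : Fin N → ℤ := fun j => rightTight v i j with hl
  set u : Fin N → ℤ := fun j => leftTight v i j with hu
  let E : κ → Fin N → GTIndex n → ℤ := fun k j => unitTriangle n (i + 1) j + T k j
  have hr : ∀ k j, rowHom n (i + 1) N (E k j) = Pi.single j 1 := fun k j =>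
    rowHom_unitTriangle_add (by omega) (hT k j) j
  have hE1 : ∀ k j, specHom n (single (E k j) 1) ≠ 1 := fun k j =>
    specHom_unitTriangle_add_ne_one (by omega) (hT k j) j
  have hE0 : ∀ k j (P : GTIndex n), (P.row : ℕ) ≤ i → E k j P = 0 := by
    intro k j P hP
    simp only [E, Pi.add_apply, unitTriangle]
    rw [if_neg (by omega), hT k j P (by omega), add_zero]
  let d : κ → LaurentPoly (GTIndex n) := fun k => ∏ j, (1 - single (E k j) 1)
  have hd : ∀ k, specHom n (d k) ≠ 0 := by
    intro k
    simp only [d, map_prod, Finset.prod_ne_zero_iff, map_sub, map_one, sub_ne_zero]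
    exact fun j _ => (hE1 k j).symm
  let num : κ → (Fin (N + 1) → ℤ) → LaurentPoly (GTIndex n) := fun k y =>
    ∏ j, (single (y j.succ • E k j) (l j) - single ((y j.castSucc + 1) • E k j) (u j))
  let Y : (Fin (N + 1) → ℤ) → GTIndex n → ℤ := fun y => ∑ j, y j • unitTriangle n i j
  -- the weighted sum over row `i + 1`
  have hsum : ∀ y, ((∏ k, d k) * q).mulSeries (signedSeries v i (N + 1) y) =
      (single (Y y) 1 * ∑ k, p k * ((∏ k' ∈ Finset.univ.erase k, d k') * num k y)).coeff := by
    intro y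
    let ψ : Fin N → ℤ → ℤ := fun j => intervalWeight (entry v i j = entry v (i + 1) j)
      (entry v i (j + 1) = entry v (i + 1) j) (y j.castSucc) (y j.succ)
    have htot : q.mulSeries (weightedTotal (rowHom n (i + 1) N) (fun z => ∏ j, ψ j (z j))
        (signedSeries v (i + 1) N)) =
        ∑ k, (p k).mulSeries (latticeSeries (rowHom n (i + 1) N) (E k) ψ) := by
      rw [mulSeries_weightedTotal_eq_sum (p := p)
        (h := fun k z => (single (∑ j, z j • E k j) 1 : LaurentPoly (GTIndex n)).coeff)]
      · simp only [weightedTotal_single]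
      · intro z A hA
        exact rowHom_of_signedSeries_ne_zero hA
      · intro k z A hA
        rw [coeff_single, Finsupp.single_apply] at hA
        have : ∑ j, z j • E k j = A := by
          by_contra h'
          exact hA (if_neg h')
        rw [← this, map_sum_smul_of_dual (hr k)]
      · intro z
        rw [(h z).1]
        simp only [LaurentPoly.mulSeries_coeff]
        ext A
        simp [Finsupp.finsetSum_apply, E]
    have hlat : ∀ k, (d k).mulSeries (latticeSeries (rowHom n (i + 1) N) (E k) ψ) =
        (num k y).coeff := by
      intro k
      exact prod_mulSeries_latticeSeries (hr k) ψ (l := l) (u := u) (a := fun j => y j.succ)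
        (b := fun j => y j.castSucc) fun j z => intervalWeight_sub _ _ _ _ z
    rw [signedSeries_succ v hi, ← LaurentPoly.mul_mulSeries, mul_comm, LaurentPoly.mul_mulSeries,
      LaurentPoly.mul_mulSeries, htot, LaurentPoly.mulSeries_sum, ← LaurentPoly.mulSeries_coeff]
    congr 1
    ext A
    rw [Finset.sum_apply, coeff_sum, Finsupp.finsetSum_apply]
    refine Finset.sum_congr rfl fun k _ => ?_
    rw [← LaurentPoly.mulSeries_coeff, ← LaurentPoly.mulSeries_coeff, ← hlat,
      ← LaurentPoly.mul_mulSeries, ← LaurentPoly.mul_mulSeries, ← LaurentPoly.mul_mulSeries,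
      ← Finset.mul_prod_erase Finset.univ d (Finset.mem_univ k)]
    congr 1
    ring
  -- the resulting family is again a combination of monomials with exponents linear in `y`
  let p' : κ × (Fin N → Bool) → LaurentPoly (GTIndex n) := fun k =>
    p k.1 * ((∏ k' ∈ Finset.univ.erase k.1, d k') *
      single (∑ j, if k.2 j then 0 else E k.1 j) (∏ j, if k.2 j then l j else -u j))
  let T' : κ × (Fin N → Bool) → Fin (N + 1) → GTIndex n → ℤ := fun k j' =>
    ∑ j, if (if k.2 j then j.succ else j.castSucc) = j' then E k.1 j else 0
  have hexp : ∀ y, single (Y y) 1 * ∑ k, p k * ((∏ k' ∈ Finset.univ.erase k, d k') * num k y) =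
      ∑ k, p' k * single (∑ j, y j • (unitTriangle n i j + T' k j)) 1 := by
    intro y
    rw [Fintype.sum_prod_type, Finset.mul_sum]
    refine Finset.sum_congr rfl fun k _ => ?_
    have hnum : num k y = _ := prod_single_sub_single_eq_sum (E k) l u y
    rw [hnum, Finset.mul_sum, Finset.mul_sum, Finset.mul_sum]
    refine Finset.sum_congr rfl fun f _ => ?_
    simp only [smul_add, Finset.sum_add_distrib]
    have hs : (single (Y y + ∑ j, y j • T' (k, f) j) 1 : LaurentPoly (GTIndex n)) =
        single (Y y) 1 * single (∑ j, y j • T' (k, f) j) 1 := by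
      rw [single_mul_single, mul_one]
    rw [hs]
    simp only [p', T']
    ring
  refine ⟨(∏ k, d k) * q, κ × (Fin N → Bool), inferInstance, p', T', ?_, ?_, ?_⟩
  · intro k j P hP
    simp only [T', Finset.sum_apply]
    refine Finset.sum_eq_zero fun j' _ => ?_
    by_cases hc : (if k.2 j' then j'.succ else j'.castSucc) = j
    · rw [if_pos hc]
      exact hE0 _ _ P hP
    · rw [if_neg hc, Pi.zero_apply]
  · rw [map_mul, map_prod]
    exact mul_ne_zero (Finset.prod_ne_zero_iff.2 fun k _ => hd k) hq
  · intro y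
    rw [← hexp y]
    refine ⟨hsum y, ?_⟩
    rw [map_mul, map_sum]
    have hYy : specHom n (single (Y y) 1) =
        ∏ j : Fin (N + 1), specHom n (single (unitTriangle n i j) 1) ^ y j := by
      rw [specHom_single_sum]
      exact Finset.prod_congr rfl fun j _ => by rw [specHom_single_smul, Int.cast_one, one_mul]
    have hval := sum_congr_of_sum_characters (c := fun k => specHom n (p k))
      (w := fun k j => specHom n (single (E k j) 1)) (c' := fun k => specHom n q * c k) (w' := w)
      (fun k j => specHom_single_ne_zero _) hw (fun z => ?_) (rowKernel l u y)
    · have hterm : ∀ k, specHom n (p k * ((∏ k' ∈ Finset.univ.erase k, d k') * num k y)) =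
          specHom n (∏ k, d k) * (specHom n (p k) *
            rowKernel l u y fun j => specHom n (single (E k j) 1)) := by
        intro k
        have hk : specHom n (num k y) =
            specHom n (d k) * rowKernel l u y fun j => specHom n (single (E k j) 1) := by
          simp only [num, d, rowKernel, map_prod, map_sub, map_one, specHom_single_smul,
            ← Finset.prod_mul_distrib]
          refine Finset.prod_congr rfl fun j _ => ?_
          rw [mul_div_cancel₀ _ (sub_ne_zero.2 (hE1 k j).symm)]
        rw [map_mul, map_mul, hk, ← Finset.mul_prod_erase Finset.univ d (Finset.mem_univ k),
          map_mul]
        ring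
      simp only [hterm]
      rw [← Finset.mul_sum, hval, hYy, map_mul]
      simp only [mul_assoc, ← Finset.mul_sum]
      ring
    · have := (h z).2
      rw [hVw, Finset.mul_sum] at this
      simp only [mul_assoc]
      rw [← this, map_sum]
      refine Finset.sum_congr rfl fun k _ => ?_
      rw [map_mul, specHom_single_sum]
      congr 1
      exact Finset.prod_congr rfl fun j _ => by rw [specHom_single_smul, Int.cast_one, one_mul]

theorem HasRowValue.base (v : GTIndex n → ℝ) : HasRowValue v n 0 fun _ => 1 := by
  classical
  refine ⟨1, Unit, inferInstance, fun _ => 1, fun _ => 0, by simp, by simp, fun y => ⟨?_, ?_⟩⟩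
  · ext A
    rw [LaurentPoly.one_mulSeries]
    have h1 : (∀ p : GTIndex n, (p.row : ℕ) < n → A p = 0) ↔ 0 = A := by
      constructor
      · intro h; ext p; exact (h p p.row.2).symm
      · rintro rfl; simp
    have h2 : (Finset.univ.filter fun p : GTIndex n => n < (p.row : ℕ)) = ∅ := by
      ext p
      have := p.row.2
      simp only [Finset.mem_filter, Finset.mem_univ, true_and, Finset.notMem_empty, iff_false]
      omega
    unfold signedSeries
    simp only [h2, h1, Subsingleton.elim _ y, and_true, Finset.prod_empty]
    simp [AddMonoidAlgebra.one_def, Finsupp.single_apply]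
  · simp [AddMonoidAlgebra.one_def]

end RowValue

/-! ### Determinants attached to rows of triangles -/

section RowDet

theorem det_eq_prod_diag_of_blockTriangular {m α R : Type*} [Fintype m] [DecidableEq m]
    [CommRing R] [LinearOrder α] {M : Matrix m m R} {b : m → α} (hb : Function.Injective b)
    (hM : M.BlockTriangular b) : M.det = ∏ i, M i i := by
  rw [hM.det, Finset.prod_image (fun _ _ _ _ h => hb h)]
  refine Finset.prod_congr rfl fun i _ => ?_
  let : Unique { j // b j = b i } := ⟨⟨⟨i, rfl⟩⟩, fun j => Subtype.ext (hb j.2)⟩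
  rw [Matrix.det_unique]
  rfl

variable {K : Type*} [Field K] {N : ℕ}

open Classical in
/-- The determinant with entries `X q ^ (y j - j)` where `a j = μ q`, and `0` elsewhere. -/
noncomputable def rowDet (a μ : Fin N → ℝ) (X : Fin N → K) (y : Fin N → ℤ) : K :=
  Matrix.det (Matrix.of fun q j => if a j = μ q then X q ^ (y j - (j : ℤ)) else 0)

open Classical in
/-- The coefficient of the character belonging to `σ` in `rowDet`. -/
noncomputable def rowDetCoeff (a μ : Fin N → ℝ) (X : Fin N → K) (σ : Equiv.Perm (Fin N)) : K :=
  (Equiv.Perm.sign σ : ℤ) * ∏ j, if a j = μ (σ j) then X (σ j) ^ (-(j : ℤ)) else 0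

theorem rowDet_eq_sum (a μ : Fin N → ℝ) {X : Fin N → K} (hX : ∀ q, X q ≠ 0) (y : Fin N → ℤ) :
    rowDet a μ X y = ∑ σ, rowDetCoeff a μ X σ * ∏ j, X (σ j) ^ y j := by
  classical
  rw [rowDet, Matrix.det_apply']
  refine Finset.sum_congr rfl fun σ _ => ?_
  rw [rowDetCoeff, mul_assoc, ← Finset.prod_mul_distrib]
  congr 1
  refine Finset.prod_congr rfl fun j _ => ?_
  rw [Matrix.of_apply, ite_mul, zero_mul, ← zpow_add₀ (hX _), neg_add_eq_sub]

open Classical in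
/-- The entries of the matrix of `rowDet` at the upper one of two rows, with weights `W`. -/
noncomputable def upperMatrix (a μ : Fin (N + 1) → ℝ) (W : Fin (N + 1) → Fin (N + 1) → K) :
    Matrix (Fin (N + 1)) (Fin (N + 1)) K :=
  Matrix.of fun q j => if a j = μ q then W q j else 0

open Classical in
/-- The matrix obtained from the lower rows of `upperMatrix` by subtracting neighbouring columns,
where the entries `b` of the lower row equal their upper neighbours. -/
noncomputable def differenceMatrix (a μ : Fin (N + 1) → ℝ) (b : Fin N → ℝ)
    (W : Fin (N + 1) → Fin (N + 1) → K) : Matrix (Fin N) (Fin N) K :=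
  Matrix.of fun q j => (if a j.castSucc = b j then upperMatrix a μ W q.succ j.castSucc else 0) -
    (if a j.succ = b j then upperMatrix a μ W q.succ j.succ else 0)

/-- If the upper row contains the lower row with an extra entry at place `k`, the column
differences do not change the determinant up to sign. -/
theorem det_differenceMatrix {a μ : Fin (N + 1) → ℝ} {b : Fin N → ℝ} (ha : Antitone a)
    {k : Fin (N + 1)} (hk : a k = μ 0) (hb : ∀ j, b j = a (k.succAbove j))
    {W : Fin (N + 1) → Fin (N + 1) → K} (hW : ∀ j, W 0 j = 1) :
    (differenceMatrix a μ b W).det = (-1) ^ N * (upperMatrix a μ W).det := by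
  classical
  -- column `k` of `B` is a unit vector, the others take the differences
  let B : Matrix (Fin (N + 1)) (Fin (N + 1)) K := Matrix.of fun r c =>
    Fin.insertNth (α := fun _ => K) k (if r = k then 1 else 0)
      (fun j => (if a j.castSucc = b j then if r = j.castSucc then 1 else 0 else 0) -
        (if a j.succ = b j then if r = j.succ then 1 else 0 else 0)) c
  have hBk : ∀ r, B r k = if r = k then 1 else 0 := fun r => by simp [B]
  have hBs : ∀ r j, B r (k.succAbove j) =
      (if a j.castSucc = b j then if r = j.castSucc then 1 else 0 else 0) -
        (if a j.succ = b j then if r = j.succ then 1 else 0 else 0) := fun r j => by simp [B]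
  -- `B` is triangular when places are ordered by their distance to `k`
  let o : Fin (N + 1) → ℕ := fun c =>
    if (c : ℕ) ≤ k then 2 * ((k : ℕ) - c) else 2 * ((c : ℕ) - k) - 1
  have ho : Function.Injective o := by
    intro c c' h
    simp only [o] at h
    apply Fin.ext
    split_ifs at h <;> omega
  have hlow : ∀ j : Fin N, (j : ℕ) < k → k.succAbove j = j.castSucc := fun j hj =>
    Fin.succAbove_of_castSucc_lt _ _ hj
  have hhigh : ∀ j : Fin N, (k : ℕ) ≤ j → k.succAbove j = j.succ := fun j hj =>
    Fin.succAbove_of_le_castSucc _ _ hj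
  have htri : B.BlockTriangular o := by
    intro r c hrc
    obtain rfl | ⟨j, rfl⟩ := Fin.eq_self_or_eq_succAbove k c
    · rw [hBk, if_neg]
      rintro rfl
      exact lt_irrefl _ hrc
    · rw [hBs]
      have h1 : r ≠ j.castSucc := by
        rintro rfl
        rcases lt_or_ge (j : ℕ) k with h | h
        · rw [hlow j h] at hrc; exact lt_irrefl _ hrc
        · rw [hhigh j h] at hrc
          simp only [o, Fin.val_succ, Fin.val_castSucc] at hrc
          split_ifs at hrc <;> omega
      have h2 : r ≠ j.succ := by
        rintro rfl
        rcases lt_or_ge (j : ℕ) k with h | h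
        · rw [hlow j h] at hrc
          simp only [o, Fin.val_succ, Fin.val_castSucc] at hrc
          split_ifs at hrc <;> omega
        · rw [hhigh j h] at hrc; exact lt_irrefl _ hrc
      simp [h1, h2]
  have hdiag : ∀ c, B c c = if k < c then -1 else 1 := by
    intro c
    obtain rfl | ⟨j, rfl⟩ := Fin.eq_self_or_eq_succAbove k c
    · simp [hBk]
    · rw [hBs, hb]
      rcases lt_or_ge (j : ℕ) k with h | h
      · rw [hlow j h, if_pos rfl, if_pos rfl,
          if_neg (not_lt.2 (Fin.le_def.2 (by simpa using h.le)))]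
        simp [Fin.castSucc_lt_succ.ne]
      · rw [hhigh j h, if_pos rfl, if_pos rfl, if_pos (Fin.lt_def.2 (by simp; omega))]
        simp [Fin.castSucc_lt_succ.ne']
  have hdetB : B.det = (-1) ^ (N - (k : ℕ)) := by
    rw [det_eq_prod_diag_of_blockTriangular ho htri]
    simp only [hdiag]
    rw [Finset.prod_ite, Finset.prod_const, Finset.prod_const_one, mul_one]
    congr 1
    have : (Finset.univ.filter fun c => k < c) = Finset.Ioi k := by ext; simp
    rw [this, Fin.card_Ioi]
    omega
  set D := upperMatrix a μ W with hD
  have hprod : ∀ q j, (D * B) q (k.succAbove j) =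
      (if a j.castSucc = b j then D q j.castSucc else 0) -
        (if a j.succ = b j then D q j.succ else 0) := by
    intro q j
    simp only [Matrix.mul_apply, hBs, mul_sub, Finset.sum_sub_distrib]
    congr 1 <;> split_ifs <;> simp
  have hrow : ∀ j, (D * B) 0 (k.succAbove j) = 0 := by
    intro j
    have h1 : (if a j.castSucc = b j then D 0 j.castSucc else 0) =
        if a j.castSucc = b j ∧ b j = μ 0 then 1 else 0 := by
      by_cases h : a j.castSucc = b j <;> simp [hD, upperMatrix, h, hW]
    have h2 : (if a j.succ = b j then D 0 j.succ else 0) =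
        if a j.succ = b j ∧ b j = μ 0 then 1 else 0 := by
      by_cases h : a j.succ = b j <;> simp [hD, upperMatrix, h, hW]
    -- an entry equal to `μ 0 = a k` equals all upper entries between it and place `k`
    have h3 : b j = μ 0 → a j.castSucc = b j ∧ a j.succ = b j := by
      intro h
      rcases lt_or_ge (j : ℕ) k with hj | hj
      · have e := hb j
        rw [hlow j hj] at e
        refine ⟨e.symm, le_antisymm ?_ ?_⟩
        · rw [e]; exact ha Fin.castSucc_lt_succ.le
        · rw [h, ← hk]; exact ha (Fin.le_def.2 (by simp; omega))
      · have e := hb j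
        rw [hhigh j hj] at e
        refine ⟨le_antisymm ?_ ?_, e.symm⟩
        · rw [h, ← hk]; exact ha (Fin.le_def.2 (by simpa using hj))
        · rw [e]; exact ha Fin.castSucc_lt_succ.le
    rw [hprod, h1, h2]
    by_cases h : b j = μ 0
    · simp [h3 h, h]
    · simp [h]
  have hrowk : (D * B) 0 k = 1 := by
    simp only [Matrix.mul_apply, hBk]
    simp [hD, upperMatrix, hk, hW]
  have hdet : (D * B).det = (-1) ^ (k : ℕ) * (differenceMatrix a μ b W).det := by
    rw [Matrix.det_succ_row_zero, Fin.sum_univ_succAbove _ k]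
    rw [Finset.sum_eq_zero (fun j _ => by rw [hrow]; ring), add_zero, hrowk, mul_one]
    congr 2
    ext q j
    rw [Matrix.submatrix_apply, hprod]
    rfl
  rw [Matrix.det_mul, hdetB] at hdet
  have hkN : (k : ℕ) ≤ N := by omega
  have hs : ((-1 : K) ^ (k : ℕ)) * (-1) ^ (k : ℕ) = 1 := by rw [← mul_pow]; simp
  have hN : (-1 : K) ^ N = (-1) ^ (k : ℕ) * (-1) ^ (N - (k : ℕ)) := by
    rw [← pow_add]; congr 1; omega
  calc _ = ((-1 : K) ^ (k : ℕ) * (-1) ^ (k : ℕ)) * (differenceMatrix a μ b W).det := by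
        rw [hs, one_mul]
    _ = (-1) ^ (k : ℕ) * (D.det * (-1) ^ (N - (k : ℕ))) := by rw [hdet]; ring
    _ = _ := by rw [hN]; ring

open Classical in
/-- If some value occurs more often in the lower row than in the upper row, the rows of the matrix
of differences belonging to this value are linearly dependent. -/
theorem det_differenceMatrix_eq_zero {a μ : Fin (N + 1) → ℝ} {b : Fin N → ℝ} {t : ℝ}
    (ht : (Finset.univ.filter fun j => a j = t).card <
      (Finset.univ.filter fun q : Fin N => μ q.succ = t).card)
    (W : Fin (N + 1) → Fin (N + 1) → K) : (differenceMatrix a μ b W).det = 0 := by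
  let f : ({q : Fin N // μ q.succ = t} → K) →ₗ[K] ({j // a j = t} → K) :=
    { toFun := fun c j => ∑ q, c q * upperMatrix a μ W q.1.succ j
      map_add' := fun c c' => by ext j; simp [add_mul, Finset.sum_add_distrib]
      map_smul' := fun x c => by ext j; simp [Finset.mul_sum, mul_assoc] }
  have hf : LinearMap.ker f ≠ ⊥ := by
    apply LinearMap.ker_ne_bot_of_finrank_lt
    rw [Module.finrank_fintype_fun_eq_card, Module.finrank_fintype_fun_eq_card,
      Fintype.card_subtype, Fintype.card_subtype]
    exact ht
  obtain ⟨c, hc, hc0⟩ := Submodule.exists_mem_ne_zero_of_ne_bot hf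
  have hsum : ∀ j, ∑ q : {q : Fin N // μ q.succ = t}, c q * upperMatrix a μ W q.1.succ j = 0 := by
    intro j
    by_cases hj : a j = t
    · exact congrFun hc ⟨j, hj⟩
    · refine Finset.sum_eq_zero fun q _ => ?_
      rw [upperMatrix, Matrix.of_apply, if_neg (by rw [q.2]; exact hj), mul_zero]
  rw [← Matrix.exists_vecMul_eq_zero_iff]
  refine ⟨fun q => if h : μ q.succ = t then c ⟨q, h⟩ else 0, ?_, ?_⟩
  · intro h
    apply hc0
    ext q
    have := congrFun h q.1
    simpa [q.2] using this
  · ext j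
    simp only [Matrix.vecMul, dotProduct, Pi.zero_apply]
    have hext : ∀ g : Fin N → K, ∑ q, (if h : μ q.succ = t then c ⟨q, h⟩ else 0) * g q =
        ∑ q : {q : Fin N // μ q.succ = t}, c q * g q := by
      intro g
      have h0 : ∑ q : Fin N with ¬ μ q.succ = t,
          (if h : μ q.succ = t then c ⟨q, h⟩ else 0) * g q = 0 :=
        Finset.sum_eq_zero fun q hq => by rw [dif_neg (Finset.mem_filter.1 hq).2, zero_mul]
      rw [← Finset.sum_filter_add_sum_filter_not Finset.univ (fun q : Fin N => μ q.succ = t), h0,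
        add_zero, Finset.sum_subtype (p := fun q : Fin N => μ q.succ = t) _ (by simp)]
      exact Finset.sum_congr rfl fun q _ => by rw [dif_pos q.2]
    rw [hext]
    simp only [differenceMatrix, Matrix.of_apply, mul_sub, Finset.sum_sub_distrib, mul_ite,
      mul_zero]
    split_ifs <;> simp [hsum]

end RowDet

/-! ### Rational values of rows -/

section Constants

variable {K : Type*} [Field K]

/-- The product of `X i * X j / (X i - X j)` over all pairs `i < j`. -/
noncomputable def weylConst {N : ℕ} (X : Fin N → K) : K :=
  ∏ i, ∏ j ∈ Finset.Ioi i, X i * X j / (X i - X j)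

theorem weylConst_succ {N : ℕ} (X : Fin (N + 1) → K) :
    weylConst X = (∏ q : Fin N, X 0 * X q.succ / (X 0 - X q.succ)) *
      weylConst fun q : Fin N => X q.succ := by
  rw [weylConst, Fin.prod_univ_succ, Fin.prod_Ioi_zero]
  simp only [Fin.prod_Ioi_succ]
  rfl

variable {N : ℕ} {X : Fin (N + 1) → K}

open Classical in
/-- Summing the kernels of all characters of a lower row gives a determinant for the upper row. -/
theorem sum_rowDetCoeff_mul_rowKernel (hX : ∀ q, X q ≠ 0) (hinj : Function.Injective X)
    (a μ : Fin (N + 1) → ℝ) (b : Fin N → ℝ) (y : Fin (N + 1) → ℤ) :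
    ∑ σ, rowDetCoeff b (fun q => μ q.succ) (fun q => X q.succ) σ *
      rowKernel (fun j => if a j.succ = b j then 1 else 0)
        (fun j => if a j.castSucc = b j then 1 else 0) y (fun j => X (σ j).succ / X 0) =
    (∏ q : Fin N, X q.succ / (X q.succ - X 0)) * ((∏ j : Fin N, X 0 ^ (-((j : ℕ) : ℤ))) *
      (differenceMatrix a μ b fun q j => (X q / X 0) ^ (y j - ((j : ℕ) : ℤ))).det) := by
  rw [← Matrix.det_mul_row, ← Matrix.det_mul_column, Matrix.det_apply']
  refine Finset.sum_congr rfl fun σ _ => ?_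
  rw [rowDetCoeff, rowKernel, mul_assoc, ← Finset.prod_mul_distrib]
  congr 1
  refine Finset.prod_congr rfl fun j _ => ?_
  simp only [Matrix.of_apply, differenceMatrix, upperMatrix]
  set q := σ j
  have hq : X q.succ - X 0 ≠ 0 := sub_ne_zero.2 fun h => Fin.succ_ne_zero q (hinj h)
  by_cases hb : b j = μ q.succ
  · have h1 : ∀ c : Fin (N + 1), (if a c = b j then if a c = μ q.succ then
        (X q.succ / X 0) ^ (y c - ((c : ℕ) : ℤ)) else 0 else 0) =
        (if a c = b j then 1 else 0) * (X q.succ / X 0) ^ (y c - ((c : ℕ) : ℤ)) := by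
      intro c
      by_cases h : a c = b j
      · simp [h, hb]
      · simp [h]
    rw [h1, h1, if_pos hb]
    have hw : X q.succ / X 0 ≠ 0 := div_ne_zero (hX _) (hX _)
    have hw1 : 1 - X q.succ / X 0 ≠ 0 := by
      rw [sub_ne_zero]
      intro h
      apply hq
      rw [eq_div_iff (hX 0), one_mul] at h
      rw [h, sub_self]
    have e1 : X q.succ / (X q.succ - X 0) = -((X q.succ / X 0) / (1 - X q.succ / X 0)) := by
      have h2 : 1 - X q.succ / X 0 = -((X q.succ - X 0) / X 0) := by
        rw [sub_div, div_self (hX 0), neg_sub]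
      rw [h2, div_neg, neg_neg, div_div_div_cancel_right₀ (hX 0)]
    have e2 : X q.succ = (X q.succ / X 0) * X 0 := by rw [div_mul_cancel₀ _ (hX 0)]
    rw [e1, e2, mul_div_cancel_right₀ _ (hX 0)]
    generalize X q.succ / X 0 = w at *
    rw [mul_zpow, Fin.val_succ, Fin.val_castSucc]
    rw [zpow_sub₀ hw, zpow_sub₀ hw, zpow_add₀ hw, zpow_neg, zpow_neg]
    push_cast
    rw [zpow_add₀ hw, zpow_one]
    have hwj : w ^ ((j : ℕ) : ℤ) ≠ 0 := zpow_ne_zero _ hw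
    have hXj : X 0 ^ ((j : ℕ) : ℤ) ≠ 0 := zpow_ne_zero _ (hX 0)
    field_simp
    ring
  · have h1 : ∀ c : Fin (N + 1), (if a c = b j then if a c = μ q.succ then
        (X q.succ / X 0) ^ (y c - ((c : ℕ) : ℤ)) else 0 else 0) = 0 := by
      intro c
      by_cases h : a c = b j
      · simp [h, hb]
      · simp [h]
    rw [h1, h1, if_neg hb]
    ring

open Classical in
/-- If the upper row is the lower row with the extra entry `μ 0`, the values for the lower row sum
up to the values for the upper row. -/
theorem weylConst_mul_sum_rowKernel (hX : ∀ q, X q ≠ 0) (hinj : Function.Injective X)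
    {a μ : Fin (N + 1) → ℝ} {b : Fin N → ℝ} (ha : Antitone a) {k : Fin (N + 1)} (hk : a k = μ 0)
    (hb : ∀ j, b j = a (k.succAbove j)) (y : Fin (N + 1) → ℤ) :
    weylConst (fun q : Fin N => X q.succ) *
      ∑ σ, rowDetCoeff b (fun q => μ q.succ) (fun q => X q.succ) σ *
        rowKernel (fun j => if a j.succ = b j then 1 else 0)
          (fun j => if a j.castSucc = b j then 1 else 0) y (fun j => X (σ j).succ / X 0) =
    weylConst X * (∏ j, (X 0)⁻¹ ^ y j) * rowDet a μ X y := by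
  rw [sum_rowDetCoeff_mul_rowKernel hX hinj, det_differenceMatrix ha hk hb
    (by intro j; rw [div_self (hX 0), one_zpow]), weylConst_succ]
  have h1 : (upperMatrix a μ fun q j => (X q / X 0) ^ (y j - ((j : ℕ) : ℤ))).det =
      (∏ j : Fin (N + 1), X 0 ^ (((j : ℕ) : ℤ) - y j)) * rowDet a μ X y := by
    rw [rowDet, ← Matrix.det_mul_row]
    congr 1
    ext q j
    simp only [upperMatrix, Matrix.of_apply, mul_ite, mul_zero]
    rw [div_zpow, div_eq_mul_inv, ← zpow_neg, neg_sub, mul_comm]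
  have h2 : (∏ j : Fin N, X 0 ^ (-((j : ℕ) : ℤ))) * ∏ j : Fin (N + 1), X 0 ^ (((j : ℕ) : ℤ) - y j)
      = X 0 ^ N * ∏ j, (X 0)⁻¹ ^ y j := by
    simp only [zpow_sub₀ (hX 0), Finset.prod_div_distrib, inv_zpow, zpow_neg,
      Finset.prod_inv_distrib]
    rw [Fin.prod_univ_castSucc (fun j : Fin (N + 1) => X 0 ^ (((j : ℕ) : ℤ)))]
    have : ∏ j : Fin N, X 0 ^ ((j : ℕ) : ℤ) ≠ 0 :=
      Finset.prod_ne_zero_iff.2 fun _ _ => zpow_ne_zero _ (hX 0)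
    simp only [Fin.val_castSucc, Fin.val_last, zpow_natCast] at this ⊢
    field_simp
  have h3 : (∏ q : Fin N, X 0 * X q.succ / (X 0 - X q.succ)) =
      (-1) ^ N * X 0 ^ N * ∏ q : Fin N, X q.succ / (X q.succ - X 0) := by
    have : ∀ c : K, c ^ N = ∏ _q : Fin N, c := by simp
    rw [this, this, ← Finset.prod_mul_distrib, ← Finset.prod_mul_distrib]
    refine Finset.prod_congr rfl fun q _ => ?_
    rw [← neg_sub (X q.succ) (X 0), div_neg]
    ring
  rw [h1, h3]
  calc _ = weylConst (fun q : Fin N => X q.succ) * (∏ q : Fin N, X q.succ / (X q.succ - X 0)) *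
        (-1) ^ N * ((∏ j : Fin N, X 0 ^ (-((j : ℕ) : ℤ))) *
          ∏ j : Fin (N + 1), X 0 ^ (((j : ℕ) : ℤ) - y j)) * rowDet a μ X y := by ring
    _ = _ := by rw [h2]; ring

end Constants

theorem eq_of_antitone_of_map_eq {N : ℕ} {f g : Fin N → ℝ} (hf : Antitone f) (hg : Antitone g)
    (h : Finset.univ.val.map f = Finset.univ.val.map g) : f = g := by
  rw [Fin.univ_val_map, Fin.univ_val_map, Multiset.coe_eq_coe] at h
  apply List.ofFn_injective
  exact h.eq_of_sortedGE hf.sortedGE_ofFn hg.sortedGE_ofFn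

theorem map_univ_succAbove {N : ℕ} {α : Type*} (f : Fin (N + 1) → α) (k : Fin (N + 1)) :
    Finset.univ.val.map f = f k ::ₘ Finset.univ.val.map fun j => f (k.succAbove j) := by
  rw [Fin.univ_succAbove N k]
  simp [Function.comp_def]

section Rows

variable {n : ℕ}

/-- The variable `x_k`, and `1` beyond the last variable. -/
noncomputable def xvar (n k : ℕ) : RatFn (Fin n) := if h : k < n then RatFn.var ⟨k, h⟩ else 1

theorem xvar_ne_zero (k : ℕ) : xvar n k ≠ 0 := by
  unfold xvar
  split_ifs
  · exact RatFn.var_ne_zero _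
  · exact one_ne_zero

theorem var_injective {ι : Type} : Function.Injective (RatFn.var : ι → RatFn ι) := by
  intro i j h
  exact MvPolynomial.X_injective (IsFractionRing.injective (MvPolynomial ι ℚ) (RatFn ι) h)

theorem xvar_injective {i N : ℕ} (hi : i + N = n) :
    Function.Injective fun q : Fin N => xvar n (i + q) := by
  intro q q' h
  have h1 : i + (q : ℕ) < n := by omega
  have h2 : i + (q' : ℕ) < n := by omega
  simp only [xvar, dif_pos h1, dif_pos h2] at h
  have := Fin.mk.inj_iff.1 (var_injective h)
  exact Fin.ext (by omega)

/-- The quotient of the value of a variable in row `i` by `x_i`. -/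
noncomputable def rowShift (n i : ℕ) : RatFn (Fin n) := if i = 0 then 1 else (xvar n (i - 1))⁻¹

theorem specHom_unitTriangle {i j : ℕ} (h : i + j < n) :
    specHom n (AddMonoidAlgebra.single (unitTriangle n i j) 1) = rowShift n i * xvar n i := by
  rw [LaurentPoly.evalHom_single, Finset.prod_eq_single (GTIndex.mk i j h)]
  · have hi : i < n := by omega
    have hi' : i - 1 < n := by omega
    have h1 : unitTriangle n i j (GTIndex.mk i j h) = 1 := by simp [unitTriangle]
    rw [h1, Int.cast_one, one_mul, zpow_one]
    by_cases h0 : i = 0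
    · rw [gtSubst, if_pos (show ((GTIndex.mk i j h).row : ℕ) = 0 from h0), rowShift, if_pos h0,
        one_mul, xvar, dif_pos hi]
      rfl
    · rw [gtSubst, if_neg (show ¬ ((GTIndex.mk i j h).row : ℕ) = 0 from h0), rowShift, if_neg h0,
        xvar, xvar, dif_pos hi, dif_pos hi']
      rfl
  · intro p _ hp
    rw [unitTriangle, if_neg, zpow_zero]
    rintro ⟨h1, h2⟩
    exact hp (GTIndex.ext_iff'.2 ⟨h1, h2⟩)
  · simp

/-- The multiset of entries of row `i`. -/
def rowMultiset (v : GTIndex n → ℝ) (i : ℕ) : Multiset ℝ :=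
  (Finset.univ.filter fun p : GTIndex n => (p.row : ℕ) = i).val.map v

theorem sum_rowMultiset (v : GTIndex n → ℝ) (i : ℕ) : (rowMultiset v i).sum = rowSum v i := rfl

theorem rowMultiset_eq (v : GTIndex n → ℝ) {i N : ℕ} (hi : i + N = n) :
    rowMultiset v i = Finset.univ.val.map fun j : Fin N => entry v i j := by
  rw [rowMultiset, filter_row_eq hi, Finset.image_val_of_injOn (mk_injective hi).injOn,
    Multiset.map_map]
  refine Multiset.map_congr rfl fun j _ => ?_
  exact (entry_of_lt v (by omega)).symm

/-- The difference of two consecutive row sums. -/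
noncomputable def rowDiff (v : GTIndex n → ℝ) (i : ℕ) : ℝ := rowSum v i - rowSum v (i + 1)

/-- From row `i` on, each row is obtained from the previous one by deleting one entry, as multisets;
the deleted entry is then the difference of the row sums. -/
def DeletesFrom (v : GTIndex n → ℝ) (i : ℕ) : Prop :=
  ∀ r, i ≤ r → r < n → rowMultiset v r = rowDiff v r ::ₘ rowMultiset v (r + 1)

theorem deletesFrom_iff {v : GTIndex n → ℝ} {i : ℕ} (hi : i < n) :
    DeletesFrom v i ↔
      rowMultiset v i = rowDiff v i ::ₘ rowMultiset v (i + 1) ∧ DeletesFrom v (i + 1) := by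
  constructor
  · intro h
    exact ⟨h i le_rfl hi, fun r hr hn => h r (by omega) hn⟩
  · rintro ⟨h1, h2⟩ r hr hn
    rcases hr.eq_or_lt with rfl | hlt
    · exact h1
    · exact h2 r hlt hn

/-- If each row deletes one entry, the entries of row `i` are the remaining row differences. -/
theorem DeletesFrom.map_entry_eq {v : GTIndex n → ℝ} {N : ℕ} : ∀ {i : ℕ}, i + N = n →
    DeletesFrom v i → (Finset.univ.val.map fun j : Fin N => entry v i j) =
      Finset.univ.val.map fun q : Fin N => rowDiff v (i + q) := by
  induction N with
  | zero => intro i _ _; rfl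
  | succ N ih =>
    intro i hi h
    obtain ⟨h1, h2⟩ := (deletesFrom_iff (by omega)).1 h
    rw [← rowMultiset_eq v hi, h1, rowMultiset_eq v (i := i + 1) (N := N) (by omega),
      ih (by omega) h2, map_univ_succAbove (fun q : Fin (N + 1) => rowDiff v (i + q)) 0]
    simp only [Fin.zero_succAbove, Fin.val_succ, Fin.val_zero, add_zero]
    congr 1
    refine Multiset.map_congr rfl fun q _ => ?_
    congr 1
    omega

/-- The inequalities between neighbouring rows of a Gelfand-Tsetlin pattern. -/
def Interlacing (v : GTIndex n → ℝ) : Prop :=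
  ∀ i j : ℕ, i + 1 + j < n → entry v (i + 1) j ≤ entry v i j ∧ entry v i (j + 1) ≤ entry v (i + 1) j

theorem Interlacing.antitone {v : GTIndex n → ℝ} (hv : Interlacing v) {i N : ℕ} (hi : i + N = n) :
    Antitone fun j : Fin N => entry v i j := by
  cases N with
  | zero => exact fun a => a.elim0
  | succ N =>
    rw [Fin.antitone_iff_succ_le]
    intro j
    have := hv i j (by omega)
    simpa using this.2.trans this.1

open Classical in
/-- The value of the series of triangles with given row `i`. It vanishes unless each row below
deletes one entry. -/
noncomputable def rowValue (v : GTIndex n → ℝ) (i N : ℕ) (y : Fin N → ℤ) : RatFn (Fin n) :=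
  if DeletesFrom v i then
    weylConst (fun q : Fin N => xvar n (i + q)) * (∏ j, rowShift n i ^ y j) *
      rowDet (fun j : Fin N => entry v i j) (fun q : Fin N => rowDiff v (i + q))
        (fun q : Fin N => xvar n (i + q)) y
  else 0

/-- If a row is not obtained from the previous one by deleting one entry, some value occurs more
often in it than in the previous row. -/
theorem exists_count_lt {v : GTIndex n → ℝ} {i N : ℕ} (hi : i + (N + 1) = n)
    (h : rowMultiset v i ≠ rowDiff v i ::ₘ rowMultiset v (i + 1)) :
    ∃ t, (rowMultiset v i).count t < (rowMultiset v (i + 1)).count t := by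
  by_contra! hle
  apply h
  obtain ⟨u, hu⟩ := Multiset.le_iff_exists_add.1 (Multiset.le_iff_count.2 hle)
  have hcard : u.card = 1 := by
    have := congrArg Multiset.card hu
    rw [Multiset.card_add, rowMultiset_eq v hi,
      rowMultiset_eq v (i := i + 1) (N := N) (by omega)] at this
    simp at this
    omega
  obtain ⟨c, rfl⟩ := Multiset.card_eq_one.1 hcard
  have hsum := congrArg Multiset.sum hu
  rw [Multiset.sum_add, Multiset.sum_singleton, sum_rowMultiset, sum_rowMultiset] at hsum
  have hc : c = rowDiff v i := by rw [rowDiff, hsum]; ring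
  rw [hu, hc, add_comm, Multiset.singleton_add]

theorem count_map_univ {N : ℕ} (f : Fin N → ℝ) (t : ℝ) :
    (Finset.univ.val.map f).count t = (Finset.univ.filter fun j => f j = t).card := by
  rw [Multiset.count_map]
  simp only [eq_comm (a := t)]
  rfl

theorem hasRowValue_rowValue {v : GTIndex n → ℝ} (hv : Interlacing v) {N : ℕ} :
    ∀ {i : ℕ}, i + N = n → HasRowValue v i N (rowValue v i N) := by
  classical
  induction N with
  | zero =>
    intro i hi
    obtain rfl : i = n := by omega
    convert HasRowValue.base v using 1
    ext y
    have hD : DeletesFrom v i := fun r hr hn => absurd hr (by omega)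
    rw [rowValue, if_pos hD]
    simp [weylConst, rowDet]
  | succ N ih =>
    intro i hi
    have hi' : i + 1 + N = n := by omega
    have hV := ih hi'
    set X : Fin (N + 1) → RatFn (Fin n) := fun q => xvar n (i + q) with hXdef
    have hX : ∀ q, X q ≠ 0 := fun q => xvar_ne_zero _
    have hinj : Function.Injective X := xvar_injective hi
    have hX0 : X 0 = xvar n i := by simp [hXdef]
    have hXs : (fun q : Fin N => xvar n (i + 1 + q)) = fun q : Fin N => X q.succ := by
      ext q
      simp only [hXdef, Fin.val_succ]
      congr 1
      omega
    set a : Fin (N + 1) → ℝ := fun j => entry v i j with ha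
    set b : Fin N → ℝ := fun j => entry v (i + 1) j with hb
    set μ : Fin (N + 1) → ℝ := fun q => rowDiff v (i + q) with hμ
    have hμs : (fun q : Fin N => rowDiff v (i + 1 + q)) = fun q : Fin N => μ q.succ := by
      ext q
      simp only [hμ, Fin.val_succ]
      congr 1
      omega
    by_cases hD : DeletesFrom v (i + 1)
    · have hstep := hV.step hi (κ' := Equiv.Perm (Fin N))
        (c := fun σ => weylConst (fun q : Fin N => X q.succ) *
          rowDetCoeff b (fun q => μ q.succ) (fun q => X q.succ) σ)
        (w := fun σ j => X (σ j).succ / X 0) (fun σ j => div_ne_zero (hX _) (hX _)) (by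
          intro z
          rw [rowValue, if_pos hD, hXs, hμs, rowDet_eq_sum _ _ (fun q => hX _), Finset.mul_sum]
          refine Finset.sum_congr rfl fun σ _ => ?_
          rw [rowShift, if_neg (Nat.succ_ne_zero i), Nat.add_sub_cancel, ← hX0]
          have : ∏ j, (X (σ j).succ / X 0) ^ z j =
              (∏ j, (X 0)⁻¹ ^ z j) * ∏ j, X (σ j).succ ^ z j := by
            rw [← Finset.prod_mul_distrib]
            refine Finset.prod_congr rfl fun j _ => ?_
            rw [← mul_zpow, div_eq_mul_inv, mul_comm]
          rw [this]
          ring)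
      have hl : (fun j : Fin N => rightTight v i j) = fun j => if a j.succ = b j then 1 else 0 := by
        ext j
        simp [rightTight, ha, hb]
      have hu : (fun j : Fin N => leftTight v i j) =
          fun j => if a j.castSucc = b j then 1 else 0 := by
        ext j
        simp [leftTight, ha, hb]
      rw [hl, hu] at hstep
      convert hstep using 1
      ext y
      simp only [mul_assoc (weylConst _), ← Finset.mul_sum]
      by_cases hdel : rowMultiset v i = rowDiff v i ::ₘ rowMultiset v (i + 1)
      · have hmap : Finset.univ.val.map a = μ 0 ::ₘ Finset.univ.val.map b := by
          rw [ha, hb, ← rowMultiset_eq v hi, ← rowMultiset_eq v hi', hdel]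
          simp [hμ]
        obtain ⟨k, -, hk⟩ := Multiset.mem_map.1
          (show μ 0 ∈ Finset.univ.val.map a by rw [hmap]; exact Multiset.mem_cons_self _ _)
        have haa : Antitone a := hv.antitone hi
        have hbk : b = fun j => a (k.succAbove j) := by
          apply eq_of_antitone_of_map_eq (hv.antitone hi')
            (haa.comp_monotone (Fin.strictMono_succAbove k).monotone)
          rw [map_univ_succAbove a k, hk] at hmap
          exact ((Multiset.cons_inj_right _).1 hmap).symm
        rw [weylConst_mul_sum_rowKernel hX hinj haa hk (congrFun hbk), rowValue,
          if_pos ((deletesFrom_iff (by omega)).2 ⟨hdel, hD⟩)]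
        have : ∏ j : Fin (N + 1), specHom n (AddMonoidAlgebra.single (unitTriangle n i j) 1) ^ y j =
            (∏ j, rowShift n i ^ y j) * ∏ j, X 0 ^ y j := by
          rw [← Finset.prod_mul_distrib]
          refine Finset.prod_congr rfl fun j _ => ?_
          rw [specHom_unitTriangle (by omega), hX0, mul_zpow]
        rw [this]
        have h1 : (∏ j, X 0 ^ y j) * ∏ j, (X 0)⁻¹ ^ y j = 1 := by
          rw [← Finset.prod_mul_distrib]
          exact Finset.prod_eq_one fun j _ => by rw [← mul_zpow, mul_inv_cancel₀ (hX 0), one_zpow]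
        calc _ = weylConst X * (∏ j, rowShift n i ^ y j) * rowDet a μ X y *
              ((∏ j, X 0 ^ y j) * ∏ j, (X 0)⁻¹ ^ y j) := by rw [h1, mul_one]
          _ = _ := by ring
      · obtain ⟨t, ht⟩ := exists_count_lt hi hdel
        rw [rowMultiset_eq v hi, rowMultiset_eq v hi', hD.map_entry_eq hi', hμs, count_map_univ,
          count_map_univ] at ht
        rw [sum_rowDetCoeff_mul_rowKernel hX hinj, det_differenceMatrix_eq_zero ht, rowValue,
          if_neg (fun h => hdel ((deletesFrom_iff (by omega)).1 h).1)]
        ring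
    · have hstep := hV.step hi (κ' := Empty) (c := fun k => k.elim) (w := fun k => k.elim)
        (fun k => k.elim) (by intro z; rw [rowValue, if_neg hD]; simp)
      convert hstep using 1
      ext y
      rw [rowValue, if_neg (fun h => hD ((deletesFrom_iff (by omega)).1 h).2)]
      simp

end Rows

/-! ### Tangent cones of Gelfand-Tsetlin polytopes -/

section TangentCone

variable {n : ℕ}

theorem interlacing_of_mem {lam : Fin n → ℤ} {v : GTIndex n → ℝ} (hv : v ∈ GTPolytope lam) :
    Interlacing v := by
  intro i j h
  have := hv.2 i j h
  rw [entry_of_lt v h, entry_of_lt v (show i + j < n by omega),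
    entry_of_lt v (show i + (j + 1) < n by omega)]
  exact this

theorem eventually_nonneg_add_mul {g c : ℝ} (hg : 0 ≤ g) (hc : g = 0 → 0 ≤ c) :
    ∀ᶠ ε in nhdsWithin (0 : ℝ) (Set.Ioi 0), 0 ≤ g + ε * c := by
  rcases hg.eq_or_lt with h | h
  · filter_upwards [self_mem_nhdsWithin] with ε hε
    rw [← h, zero_add]
    exact mul_nonneg (le_of_lt hε) (hc h.symm)
  · have ht : Filter.Tendsto (fun ε : ℝ => g + ε * c) (nhds 0) (nhds (g + 0 * c)) :=
      Continuous.tendsto (by fun_prop) 0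
    rw [zero_mul, add_zero] at ht
    exact ((ht.eventually (lt_mem_nhds h)).filter_mono nhdsWithin_le_nhds).mono fun ε hε => hε.le

/-- The inequalities between the entry at `p` and its upper neighbours that are equalities
for `v`. -/
def TightAt {α : Type*} [Zero α] [LE α] (v : GTIndex n → ℝ) (A : GTIndex n → α)
    (p : GTIndex n) : Prop :=
  (entry v ((p.row : ℕ) - 1) p.col = v p → A p ≤ entry A ((p.row : ℕ) - 1) p.col) ∧
  (entry v ((p.row : ℕ) - 1) ((p.col : ℕ) + 1) = v p →
    entry A ((p.row : ℕ) - 1) ((p.col : ℕ) + 1) ≤ A p)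

/-- The tangent cone is cut out by the inequalities that are equalities at its apex. -/
theorem mem_GTCone_iff {lam : Fin n → ℤ} {v : GTIndex n → ℝ} (hv : v ∈ GTPolytope lam)
    (x : GTIndex n → ℝ) :
    x ∈ GTCone lam v ↔ (∀ j : Fin n, entry x 0 j = lam j) ∧
      ∀ p : GTIndex n, 0 < (p.row : ℕ) → TightAt v x p := by
  have e0 : ∀ (A : GTIndex n → ℝ) (j : Fin n), entry A 0 j = A (GTIndex.mk 0 j (by omega)) :=
    fun A j => entry_of_lt A _
  constructor
  · rintro ⟨a, ha, t, ht, rfl⟩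
    refine ⟨fun j => ?_, fun p hp => ?_⟩
    · rw [e0]
      simp [hv.1 j, ha.1 j]
    · have hrc := p.row_add_col
      have h1 : (p.row : ℕ) - 1 + p.col < n := by omega
      have h2 : (p.row : ℕ) - 1 + (p.col + 1) < n := by omega
      have ha' := interlacing_of_mem ha ((p.row : ℕ) - 1) p.col (by omega)
      rw [Nat.sub_add_cancel hp, entry_row_col, entry_of_lt _ h1, entry_of_lt _ h2] at ha'
      unfold TightAt
      simp only [entry_of_lt _ h1, entry_of_lt _ h2, Pi.add_apply, Pi.smul_apply, Pi.sub_apply,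
        smul_eq_mul]
      constructor
      · intro h
        rw [h]
        nlinarith [mul_le_mul_of_nonneg_left ha'.1 ht]
      · intro h
        rw [h]
        nlinarith [mul_le_mul_of_nonneg_left ha'.2 ht]
  · rintro ⟨h0, hx⟩
    -- a small multiple of `x - v` stays inside the polytope
    have hev : ∀ᶠ ε in nhdsWithin (0 : ℝ) (Set.Ioi 0), ∀ i j : Fin n,
        ∀ h : (i : ℕ) + 1 + j < n,
        0 ≤ (v (GTIndex.mk i j (by omega)) - v (GTIndex.mk (i + 1) j h)) +
          ε * ((x (GTIndex.mk i j (by omega)) - v (GTIndex.mk i j (by omega))) -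
            (x (GTIndex.mk (i + 1) j h) - v (GTIndex.mk (i + 1) j h))) ∧
        0 ≤ (v (GTIndex.mk (i + 1) j h) - v (GTIndex.mk i (j + 1) (by omega))) +
          ε * ((x (GTIndex.mk (i + 1) j h) - v (GTIndex.mk (i + 1) j h)) -
            (x (GTIndex.mk i (j + 1) (by omega)) - v (GTIndex.mk i (j + 1) (by omega)))) := by
      refine Filter.eventually_all.2 fun i => Filter.eventually_all.2 fun j =>
        Filter.eventually_all.2 fun h => ?_
      have h1 : (i : ℕ) + j < n := by omega
      have h2 : (i : ℕ) + (j + 1) < n := by omega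
      have ht := hx (GTIndex.mk (i + 1) j h) (by simp)
      unfold TightAt at ht
      simp only [GTIndex.row_mk, GTIndex.col_mk, Nat.add_sub_cancel, entry_of_lt _ h1,
        entry_of_lt _ h2] at ht
      have hvi := hv.2 i j h
      refine Filter.Eventually.and ?_ ?_
      · refine eventually_nonneg_add_mul (by linarith [hvi.1]) fun hg => ?_
        have := ht.1 (by linarith)
        linarith
      · refine eventually_nonneg_add_mul (by linarith [hvi.2]) fun hg => ?_
        have := ht.2 (by linarith)
        linarith
    obtain ⟨ε, hε, hε0⟩ := (hev.and self_mem_nhdsWithin).exists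
    have hε0' : (0 : ℝ) < ε := hε0
    refine ⟨v + ε • (x - v), ⟨fun j => ?_, fun i j h => ?_⟩, ε⁻¹, by positivity, ?_⟩
    · have := h0 j
      rw [e0] at this
      simp [hv.1 j, this]
    · have := hε ⟨i, by omega⟩ ⟨j, by omega⟩ h
      simp only [Pi.add_apply, Pi.smul_apply, Pi.sub_apply, smul_eq_mul]
      simp only at this
      constructor <;> linarith [this.1, this.2]
    · rw [add_sub_cancel_left, smul_smul, inv_mul_cancel₀ hε0'.ne', one_smul, add_sub_cancel]

theorem tightAt_intCast (v : GTIndex n → ℝ) (A : GTIndex n → ℤ) (p : GTIndex n) :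
    TightAt v (fun q => (A q : ℝ)) p ↔ TightAt v A p := by
  have h : ∀ i j, entry (fun q => (A q : ℝ)) i j = ((entry A i j : ℤ) : ℝ) := by
    intro i j
    unfold entry
    split_ifs <;> simp
  simp only [TightAt, h, Int.cast_le]

/-- At the apex `v`, the signed series with the top row `λ` has no signs and is the series of the
tangent cone. -/
theorem signedSeries_zero_eq {lam : Fin n → ℤ} (hlam : Antitone lam) {v : GTIndex n → ℝ}
    (hv : v ∈ GTPolytope lam) : signedSeries v 0 n lam = genSeries (GTCone lam v) := by
  classical
  have hI := interlacing_of_mem hv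
  ext A
  have hmem : (fun i => (A i : ℝ)) ∈ GTCone lam v ↔ rowHom n 0 n A = lam ∧
      ∀ p : GTIndex n, 0 < (p.row : ℕ) → TightAt v A p := by
    rw [mem_GTCone_iff hv]
    simp only [tightAt_intCast]
    refine and_congr_left fun _ => ?_
    rw [funext_iff]
    refine forall_congr' fun j => ?_
    rw [rowHom_apply, entry_of_lt _ (show 0 + (j : ℕ) < n by omega),
      entry_of_lt A (show 0 + (j : ℕ) < n by omega), Int.cast_inj]
  have hcond : ((∀ p : GTIndex n, (p.row : ℕ) < 0 → A p = 0) ∧ rowHom n 0 n A = lam) ↔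
      rowHom n 0 n A = lam := by simp
  unfold signedSeries genSeries
  simp only [hmem, hcond]
  by_cases hrow : rowHom n 0 n A = lam
  swap
  · rw [if_neg hrow, if_neg (fun h => hrow h.1)]
  rw [if_pos hrow]
  by_cases hall : ∀ p : GTIndex n, 0 < (p.row : ℕ) → TightAt v A p
  · rw [if_pos ⟨hrow, hall⟩]
    refine Finset.prod_eq_one fun p hp => ?_
    obtain ⟨h1, h2⟩ := hall p (Finset.mem_filter.1 hp).2
    unfold entryWeight intervalWeight
    by_cases hu : entry v ((p.row : ℕ) - 1) p.col = v p
    · rw [if_pos hu, if_pos (h1 hu), if_neg (fun h => absurd (h2 h.1) (not_le.2 h.2)), sub_zero]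
    · rw [if_neg hu, if_neg (fun h => absurd (h2 h.1) (not_le.2 h.2))]
  · rw [if_neg (fun h => hall h.2)]
    -- the weight vanishes at a violated inequality in the highest possible row
    have hex : ∃ r, ∃ p : GTIndex n, (p.row : ℕ) = r ∧ 0 < (p.row : ℕ) ∧ ¬ TightAt v A p := by
      push Not at hall
      obtain ⟨p, hp, hp'⟩ := hall
      exact ⟨_, p, rfl, hp, hp'⟩
    obtain ⟨p, hpr, hp0, hp⟩ := Nat.find_spec hex
    have hmin : ∀ p' : GTIndex n, 0 < (p'.row : ℕ) → (p'.row : ℕ) < p.row → TightAt v A p' := by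
      intro p' h0 hlt
      by_contra hne
      exact Nat.find_min hex (hpr ▸ hlt) ⟨p', rfl, h0, hne⟩
    refine Finset.prod_eq_zero (i := p) (Finset.mem_filter.2 ⟨Finset.mem_univ _, hp0⟩) ?_
    have hrc := p.row_add_col
    have hdom : entry v ((p.row : ℕ) - 1) p.col = v p →
        entry v ((p.row : ℕ) - 1) ((p.col : ℕ) + 1) = v p →
        entry A ((p.row : ℕ) - 1) ((p.col : ℕ) + 1) ≤ entry A ((p.row : ℕ) - 1) p.col := by
      intro hu hl
      by_cases h1 : (p.row : ℕ) = 1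
      · rw [h1]
        have e1 := congrFun hrow ⟨p.col, by omega⟩
        have e2 := congrFun hrow ⟨p.col + 1, by omega⟩
        rw [rowHom_apply] at e1 e2
        simp only [Nat.sub_self] at e1 e2 ⊢
        rw [e1, e2]
        exact hlam (Fin.le_def.2 (by simp))
      · have ha : (p.row : ℕ) - 1 + p.col < n := by omega
        have hb : (p.row : ℕ) - 1 + (p.col + 1) < n := by omega
        have hs : (p.row : ℕ) - 1 - 1 + 1 = (p.row : ℕ) - 1 := by omega
        have i1 := (hI ((p.row : ℕ) - 1 - 1) p.col (by omega)).2
        have i2 := (hI ((p.row : ℕ) - 1 - 1) (p.col + 1) (by omega)).1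
        rw [hs] at i1 i2
        have t1 := (hmin (GTIndex.mk ((p.row : ℕ) - 1) p.col ha) (by simp; omega)
          (by simp; omega)).2
        have t2 := (hmin (GTIndex.mk ((p.row : ℕ) - 1) (p.col + 1) hb) (by simp; omega)
          (by simp; omega)).1
        simp only [GTIndex.row_mk, GTIndex.col_mk, ← entry_of_lt _ ha, ← entry_of_lt _ hb] at t1 t2
        exact (t2 (by linarith)).trans (t1 (by linarith))
    unfold entryWeight intervalWeight
    unfold TightAt at hp
    by_cases hu : entry v ((p.row : ℕ) - 1) p.col = v p <;>
      by_cases hl : entry v ((p.row : ℕ) - 1) ((p.col : ℕ) + 1) = v p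
    · have := hdom hu hl
      simp only [hu, hl, true_imp_iff, true_and, if_true] at hp ⊢
      split_ifs <;> omega
    · simp only [hu, hl, true_imp_iff, false_imp_iff, and_true, false_and, if_true,
        if_false] at hp ⊢
      rw [if_neg hp, sub_zero]
    · simp only [hu, hl, true_imp_iff, false_imp_iff, true_and, if_false] at hp ⊢
      rw [if_pos (not_le.1 hp)]
    · simp [hu, hl] at hp

/-- The integer-point transform of a tangent cone and its specialization are well defined, and the
latter is the value of the top row. -/
theorem sigma_GTCone {lam : Fin n → ℤ} (hlam : Antitone lam) {v : GTIndex n → ℝ}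
    (hv : v ∈ GTPolytope lam) :
    (∃! Q, IsIntegerPointTransform (GTCone lam v) Q) ∧
      IsSpecialization (gtSubst n) (sigma (GTCone lam v)) (rowValue v 0 n lam) := by
  obtain ⟨q, κ, _, p, T, -, hq, h⟩ :=
    hasRowValue_rowValue (interlacing_of_mem hv) (Nat.zero_add n)
  obtain ⟨h1, h2⟩ := h lam
  rw [signedSeries_zero_eq hlam hv] at h1
  rw [LaurentPoly.evalHom_apply] at hq
  have := sigma_wellDefined hq h1
  rwa [← LaurentPoly.evalHom_apply _ (gtSubst_ne_zero n), ← LaurentPoly.evalHom_apply _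
    (gtSubst_ne_zero n), h2, mul_div_cancel_left₀] at this
  rwa [LaurentPoly.evalHom_apply]

end TangentCone

/-! ### Weyl's summands -/

section Weyl

variable {n : ℕ}

theorem weylConst_eq_inv_det {K : Type*} [Field K] {N : ℕ} {X : Fin N → K} (hX : ∀ q, X q ≠ 0) :
    weylConst X = (Matrix.vandermonde fun q => (X q)⁻¹).det⁻¹ := by
  rw [Matrix.det_vandermonde, weylConst, ← Finset.prod_inv_distrib]
  refine Finset.prod_congr rfl fun i _ => ?_
  rw [← Finset.prod_inv_distrib]
  refine Finset.prod_congr rfl fun j _ => ?_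
  rw [inv_sub_inv (hX j) (hX i), inv_div, mul_comm]

theorem permRatFn_weylConst (w : Equiv.Perm (Fin n)) :
    permRatFn w (weylConst (RatFn.var (ι := Fin n))) =
      (Equiv.Perm.sign w : ℤ) * weylConst (RatFn.var (ι := Fin n)) := by
  have hs : (((Equiv.Perm.sign w : ℤ) : RatFn (Fin n)))⁻¹ = (Equiv.Perm.sign w : ℤ) := by
    rcases Int.units_eq_one_or (Equiv.Perm.sign w) with h | h <;> simp [h]
  rw [weylConst_eq_inv_det (fun q => RatFn.var_ne_zero q), map_inv₀]
  have : permRatFn w (Matrix.vandermonde fun q : Fin n => (RatFn.var q)⁻¹).det =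
      ((Matrix.vandermonde fun q : Fin n => (RatFn.var q)⁻¹).submatrix w id).det := by
    rw [RingEquiv.map_det]
    congr 1
    ext i j
    simp [Matrix.vandermonde, permRatFn_var]
  rw [this, Matrix.det_permute, mul_inv, hs]

theorem weylConst_var_ne_zero : weylConst (RatFn.var (ι := Fin n)) ≠ 0 := by
  rw [weylConst_eq_inv_det (fun q => RatFn.var_ne_zero q)]
  apply inv_ne_zero
  rw [Matrix.det_vandermonde_ne_zero_iff]
  exact fun i j h => var_injective (inv_injective h)

/-- Weyl's summand is, up to the antisymmetric factor `weylConst`, the monomial of the strictly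
decreasing weight `j ↦ λ j - j`. -/
theorem weylTerm_eq (lam : Fin n → ℤ) :
    weylTerm lam = weylConst (RatFn.var (ι := Fin n)) * expWeight fun j => lam j - (j : ℕ) := by
  have hv : ∀ i : Fin n, RatFn.var i ≠ 0 := RatFn.var_ne_zero
  have hprod : ∏ p : Fin n × Fin n with p.1 < p.2, (1 - RatFn.var p.2 / RatFn.var p.1) =
      ∏ i : Fin n, ∏ j ∈ Finset.Ioi i, (1 - RatFn.var j / RatFn.var i) := by
    rw [Finset.prod_filter, Fintype.prod_prod_type]
    refine Finset.prod_congr rfl fun i _ => ?_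
    rw [← Finset.prod_filter]
    congr 1
    ext j
    simp
  have hne : ∀ i j : Fin n, i < j → RatFn.var i - RatFn.var j ≠ 0 := fun i j h =>
    sub_ne_zero.2 fun h' => h.ne (var_injective h')
  have hmul : weylConst (RatFn.var (ι := Fin n)) *
      ∏ i : Fin n, ∏ j ∈ Finset.Ioi i, (1 - RatFn.var j / RatFn.var i) =
      ∏ j : Fin n, RatFn.var j ^ (j : ℕ) := by
    rw [weylConst, ← Finset.prod_mul_distrib]
    have h1 : ∀ i : Fin n, (∏ j ∈ Finset.Ioi i, RatFn.var i * RatFn.var j /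
        (RatFn.var i - RatFn.var j)) * ∏ j ∈ Finset.Ioi i, (1 - RatFn.var j / RatFn.var i) =
        ∏ j, if i < j then RatFn.var j else 1 := by
      intro i
      rw [← Finset.prod_mul_distrib, ← Finset.prod_filter]
      refine Finset.prod_congr (by ext; simp) fun j hj => ?_
      have h2 := hne i j (Finset.mem_Ioi.1 (by simpa using hj))
      have h3 := hv i
      field_simp
    simp only [h1]
    rw [Finset.prod_comm]
    refine Finset.prod_congr rfl fun j _ => ?_
    rw [← Finset.prod_filter, Finset.prod_const]
    congr 1
    have : (Finset.univ.filter fun i : Fin n => i < j) = Finset.Iio j := by ext; simp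
    rw [this, Fin.card_Iio]
  have hne0 : ∏ i : Fin n, ∏ j ∈ Finset.Ioi i, (1 - RatFn.var j / RatFn.var i) ≠ 0 := by
    intro h
    rw [h, mul_zero] at hmul
    exact Finset.prod_ne_zero_iff.2 (fun j _ => pow_ne_zero _ (hv j)) hmul.symm
  rw [weylTerm, hprod, div_eq_iff hne0, mul_right_comm, hmul, expWeight, expWeight,
    ← Finset.prod_mul_distrib]
  refine Finset.prod_congr rfl fun j _ => ?_
  rw [← zpow_natCast, ← zpow_add₀ (hv j)]
  congr 1
  ring

theorem permRatFn_weylTerm (w : Equiv.Perm (Fin n)) (lam : Fin n → ℤ) :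
    permRatFn w (weylTerm lam) = weylConst (RatFn.var (ι := Fin n)) *
      ((Equiv.Perm.sign w : ℤ) * expWeight (permWeight w fun j => lam j - (j : ℕ))) := by
  rw [weylTerm_eq, map_mul, permRatFn_weylConst, permRatFn_expWeight]
  ring

theorem permWeight_eq_iff (w : Equiv.Perm (Fin n)) (lam mu : Fin n → ℤ) :
    permWeight w lam = mu ↔ ∀ j, lam j = mu (w j) := by
  rw [funext_iff, ← w.forall_congr_right]
  simp [permWeight]

/-- The sum of Weyl's summands with a given weight does not vanish: after division by the
antisymmetric factor, it is a combination of different monomials. -/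
theorem sum_permRatFn_weylTerm_ne_zero {lam mu : Fin n → ℤ} (hlam : Antitone lam)
    (hmu : mu ∈ weightOrbit lam) :
    ∑ w : Equiv.Perm (Fin n) with permWeight w lam = mu, permRatFn w (weylTerm lam) ≠ 0 := by
  obtain ⟨w, hw⟩ := hmu
  simp only [permRatFn_weylTerm]
  rw [← Finset.mul_sum]
  refine mul_ne_zero weylConst_var_ne_zero (sum_expWeight_ne_zero (k := w) ?_ (by simpa using hw)
    (by simp))
  have hinj : Function.Injective fun j : Fin n => lam j - ((j : ℕ) : ℤ) := by
    apply StrictAnti.injective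
    intro i j h
    have := hlam h.le
    have : (i : ℕ) < j := h
    simp only
    omega
  intro w _ w' _ h
  have : w.symm = w'.symm := by
    ext i
    exact congrArg _ (hinj (congrFun h i))
  simpa using congrArg Equiv.symm this

theorem rowValue_zero_eq {lam mu : Fin n → ℤ} {v : GTIndex n → ℝ} (hv : v ∈ GTPolytope lam)
    (hD : DeletesFrom v 0) (hmu : ∀ i, gtWeight v i = mu i) :
    rowValue v 0 n lam =
      ∑ w : Equiv.Perm (Fin n) with permWeight w lam = mu, permRatFn w (weylTerm lam) := by
  classical
  have hX : (fun q : Fin n => xvar n (0 + q)) = RatFn.var := by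
    ext q
    simp [xvar]
  have ha : (fun j : Fin n => entry v 0 j) = fun j => (lam j : ℝ) := by
    ext j
    rw [entry_of_lt v (by omega), hv.1 j]
  have hμ : (fun q : Fin n => rowDiff v (0 + q)) = fun q => (mu q : ℝ) := by
    ext q
    rw [← hmu q, zero_add]
    rfl
  have hs : ∏ j, rowShift n 0 ^ lam j = 1 := by simp [rowShift]
  rw [rowValue, if_pos hD, hX, ha, hμ, hs, mul_one]
  simp only [permRatFn_weylTerm]
  rw [← Finset.mul_sum, rowDet, Matrix.det_apply', Finset.sum_filter]
  congr 1
  refine Finset.sum_congr rfl fun w _ => ?_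
  simp only [Matrix.of_apply, Int.cast_inj]
  rw [Finset.prod_ite_zero]
  simp only [Finset.mem_univ, true_imp_iff, permWeight_eq_iff, mul_ite, mul_zero]
  refine if_congr Iff.rfl ?_ rfl
  congr 1
  rw [← permRatFn_expWeight, expWeight, map_prod]
  exact Finset.prod_congr rfl fun j _ => by rw [map_zpow₀, permRatFn_var]

end Weyl

/-! ### Vertices whose rows delete one entry each -/

section Vertices

variable {n : ℕ}

/-- Row `r + 1` of `T` is row `r` without the entry at some place, and that entry is `m r`. -/
theorem exists_deletion_triangle {N : ℕ} : ∀ a m : Fin N → ℤ, Antitone a →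
    Finset.univ.val.map a = Finset.univ.val.map m →
    ∃ T : ℕ → ℕ → ℤ, (∀ j : Fin N, T 0 j = a j) ∧ ∀ r (hr : r < N), ∃ k, r + k < N ∧
      T r k = m ⟨r, hr⟩ ∧
      (∀ j, r + 1 + j < N → T (r + 1) j = if j < k then T r j else T r (j + 1)) ∧
      ∀ j, r + (j + 1) < N → T r (j + 1) ≤ T r j := by
  induction N with
  | zero => exact fun a m _ _ => ⟨fun _ _ => 0, fun j => j.elim0, fun r hr => absurd hr (by omega)⟩
  | succ N ih =>
    intro a m ha h
    rw [map_univ_succAbove m 0] at h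
    obtain ⟨k, -, hk⟩ := Multiset.mem_map.1
      (show m 0 ∈ Finset.univ.val.map a by rw [h]; exact Multiset.mem_cons_self _ _)
    rw [map_univ_succAbove a k, hk, Multiset.cons_inj_right] at h
    obtain ⟨T, hT0, hT⟩ := ih (fun j => a (k.succAbove j)) (fun j => m ((0 : Fin _).succAbove j))
      (ha.comp_monotone (Fin.strictMono_succAbove k).monotone) h
    refine ⟨fun r j => match r with
      | 0 => if hj : j < N + 1 then a ⟨j, hj⟩ else 0
      | r + 1 => T r j, fun j => dif_pos j.2, fun r hr => ?_⟩
    cases r with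
    | zero =>
      refine ⟨k, by omega, (dif_pos k.2).trans hk, fun j hj => ?_, fun j hj => ?_⟩
      · have hj' : j < N := by omega
        have := hT0 ⟨j, hj'⟩
        simp only at this ⊢
        rw [this]
        split_ifs with h1 h2 h2
        · rw [Fin.succAbove_of_castSucc_lt k ⟨j, hj'⟩ (Fin.lt_def.2 h1)]
          rfl
        · omega
        · rw [Fin.succAbove_of_le_castSucc k ⟨j, hj'⟩ (Fin.le_def.2 (not_lt.1 h1))]
          rfl
        · omega
      · have h1 : j < N + 1 := by omega
        have h2 : j + 1 < N + 1 := by omega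
        simp only [dif_pos h1, dif_pos h2]
        exact ha (Fin.le_def.2 (by simp))
    | succ r =>
      obtain ⟨k', hk', e1, e2, e3⟩ := hT r (by omega)
      refine ⟨k', by omega, ?_, fun j hj => e2 j (by omega), fun j hj => e3 j (by omega)⟩
      simpa using e1

theorem map_univ_permWeight (w : Equiv.Perm (Fin n)) (lam : Fin n → ℤ) :
    Finset.univ.val.map (permWeight w lam) = Finset.univ.val.map lam := by
  conv_rhs => rw [← Multiset.map_univ_val_equiv w.symm, Multiset.map_map]
  rfl

/-- A point of the polytope each of whose lower entries equals an upper neighbour is a vertex. -/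
theorem mem_GTVertices_of_eq_neighbour {lam : Fin n → ℤ} {v : GTIndex n → ℝ}
    (hv : v ∈ GTPolytope lam)
    (h : ∀ i j, i + 1 + j < n → entry v (i + 1) j = entry v i j ∨
      entry v (i + 1) j = entry v i (j + 1)) : v ∈ GTVertices lam := by
  rw [GTVertices, mem_extremePoints_iff_left]
  refine ⟨hv, fun x hx y hy hseg => ?_⟩
  obtain ⟨a, b, ha, hb, hab, rfl⟩ := hseg
  have hxI := interlacing_of_mem hx
  have hyI := interlacing_of_mem hy
  have hent : ∀ i j, entry (a • x + b • y) i j = a * entry x i j + b * entry y i j := by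
    intro i j
    unfold entry
    split_ifs <;> simp
  have key : ∀ i j, i + j < n → entry x i j = entry y i j := by
    intro i
    induction i with
    | zero =>
      intro j hj
      rw [entry_of_lt x hj, entry_of_lt y hj]
      have h1 := hx.1 ⟨j, by omega⟩
      have h2 := hy.1 ⟨j, by omega⟩
      exact h1.trans h2.symm
    | succ i ih =>
      intro j hj
      obtain ⟨x1, x2⟩ := hxI i j hj
      obtain ⟨y1, y2⟩ := hyI i j hj
      have e1 := ih j (by omega)
      have e2 := ih (j + 1) (by omega)
      have hb' : b = 1 - a := by linarith
      subst hb'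
      rcases h i j hj with h | h <;> rw [hent, hent] at h
      · have hx1 : a * (entry x i j - entry x (i + 1) j) = 0 := by
          nlinarith [mul_nonneg ha.le (sub_nonneg.2 x1), mul_nonneg hb.le (sub_nonneg.2 y1)]
        have hy1 : (1 - a) * (entry y i j - entry y (i + 1) j) = 0 := by
          nlinarith [mul_nonneg ha.le (sub_nonneg.2 x1), mul_nonneg hb.le (sub_nonneg.2 y1)]
        have := (mul_eq_zero.1 hx1).resolve_left ha.ne'
        have := (mul_eq_zero.1 hy1).resolve_left hb.ne'
        linarith
      · have hx1 : a * (entry x (i + 1) j - entry x i (j + 1)) = 0 := by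
          nlinarith [mul_nonneg ha.le (sub_nonneg.2 x2), mul_nonneg hb.le (sub_nonneg.2 y2)]
        have hy1 : (1 - a) * (entry y (i + 1) j - entry y i (j + 1)) = 0 := by
          nlinarith [mul_nonneg ha.le (sub_nonneg.2 x2), mul_nonneg hb.le (sub_nonneg.2 y2)]
        have := (mul_eq_zero.1 hx1).resolve_left ha.ne'
        have := (mul_eq_zero.1 hy1).resolve_left hb.ne'
        linarith
  have hxy : x = y := by
    ext p
    rw [← entry_row_col x, ← entry_row_col y]
    exact key _ _ p.row_add_col
  rw [← hxy, ← add_smul, hab, one_smul]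

/-- Every weight in the orbit is the weight of a vertex whose rows delete one entry each. -/
theorem exists_vertex {lam mu : Fin n → ℤ} (hlam : Antitone lam) (hmu : mu ∈ weightOrbit lam) :
    ∃ v ∈ GTVertices lam, DeletesFrom v 0 ∧ ∀ i, gtWeight v i = mu i := by
  obtain ⟨w, rfl⟩ := hmu
  obtain ⟨T, hT0, hT⟩ :=
    exists_deletion_triangle lam (permWeight w lam) hlam (map_univ_permWeight w lam).symm
  let v : GTIndex n → ℝ := fun p => T p.row p.col
  have hent : ∀ i j, i + j < n → entry v i j = T i j := fun i j h => entry_of_lt v h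
  have hnb : ∀ i j, i + 1 + j < n → (T (i + 1) j = T i j ∨ T (i + 1) j = T i (j + 1)) ∧
      T (i + 1) j ≤ T i j ∧ T i (j + 1) ≤ T (i + 1) j := by
    intro i j h
    obtain ⟨k, -, -, h2, h3⟩ := hT i (by omega)
    have h3 := h3 j (by omega)
    rw [h2 j h]
    split_ifs
    · exact ⟨Or.inl rfl, le_rfl, h3⟩
    · exact ⟨Or.inr rfl, h3, le_rfl⟩
  have hv : v ∈ GTPolytope lam := by
    refine ⟨fun j => ?_, fun i j h => ?_⟩
    · exact congrArg (Int.cast (R := ℝ)) (hT0 j)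
    · have := (hnb i j h).2
      exact ⟨Int.cast_le.2 this.1, Int.cast_le.2 this.2⟩
  have hrow : ∀ r (hr : r < n),
      rowMultiset v r = (permWeight w lam ⟨r, hr⟩ : ℝ) ::ₘ rowMultiset v (r + 1) := by
    intro r hr
    obtain ⟨k, hk, h1, h2, -⟩ := hT r hr
    obtain ⟨M, hM⟩ : ∃ M, r + (M + 1) = n := ⟨n - r - 1, by omega⟩
    have hkM : k < M + 1 := by omega
    rw [rowMultiset_eq v hM, rowMultiset_eq v (i := r + 1) (N := M) (by omega),
      map_univ_succAbove _ ⟨k, hkM⟩]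
    congr 1
    · simp only
      rw [hent r k hk, h1]
    · refine Multiset.map_congr rfl fun j _ => ?_
      rw [hent (r + 1) j (by omega), h2 j (by omega)]
      split_ifs with hjk
      · rw [Fin.succAbove_of_castSucc_lt ⟨k, hkM⟩ j (Fin.lt_def.2 hjk), Fin.val_castSucc,
          hent _ _ (by omega)]
      · rw [Fin.succAbove_of_le_castSucc ⟨k, hkM⟩ j (Fin.le_def.2 (not_lt.1 hjk)), Fin.val_succ,
          hent _ _ (by omega)]
  have hdiff : ∀ r (hr : r < n), rowDiff v r = permWeight w lam ⟨r, hr⟩ := by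
    intro r hr
    have := congrArg Multiset.sum (hrow r hr)
    rw [Multiset.sum_cons, sum_rowMultiset, sum_rowMultiset] at this
    rw [rowDiff, this, add_sub_cancel_right]
  refine ⟨v, mem_GTVertices_of_eq_neighbour hv fun i j h => ?_, fun r _ hr => ?_,
    fun i => hdiff i i.2⟩
  · rw [hent _ _ h, hent i j (by omega), hent i (j + 1) (by omega)]
    exact (hnb i j h).1.imp (congrArg _) (congrArg _)
  · rw [hdiff r hr]
    exact hrow r hr

/-- A point whose rows delete one entry each is determined by its weight. -/
theorem eq_of_gtWeight_eq {lam : Fin n → ℤ} {v v' : GTIndex n → ℝ} (hv : v ∈ GTPolytope lam)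
    (hv' : v' ∈ GTPolytope lam) (hD : DeletesFrom v 0) (hD' : DeletesFrom v' 0)
    (h : ∀ i, gtWeight v i = gtWeight v' i) : v = v' := by
  ext p
  have hp := p.row_add_col
  obtain ⟨N, hN⟩ : ∃ N, (p.row : ℕ) + N = n := ⟨n - p.row, by omega⟩
  have hrows := eq_of_antitone_of_map_eq ((interlacing_of_mem hv).antitone hN)
    ((interlacing_of_mem hv').antitone hN) (by
      rw [DeletesFrom.map_entry_eq hN fun r _ hr => hD r (Nat.zero_le r) hr,
        DeletesFrom.map_entry_eq hN fun r _ hr => hD' r (Nat.zero_le r) hr]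
      exact Multiset.map_congr rfl fun q _ => h ⟨p.row + q, by omega⟩)
  rw [← entry_row_col v, ← entry_row_col v']
  exact congrFun hrows ⟨p.col, by omega⟩

theorem exists_perm_of_map_eq {f g : Fin n → ℝ}
    (h : Finset.univ.val.map f = Finset.univ.val.map g) :
    ∃ σ : Equiv.Perm (Fin n), ∀ i, f i = g (σ i) := by
  classical
  have hcard : ∀ t, Nonempty ({i // f i = t} ≃ {i // g i = t}) := by
    intro t
    rw [← Fintype.card_eq, Fintype.card_subtype, Fintype.card_subtype, ← count_map_univ,
      ← count_map_univ, h]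
  exact ⟨Equiv.ofFiberEquiv fun t => (hcard t).some, fun i => (Equiv.ofFiberEquiv_map _ i).symm⟩

theorem exists_weight_mem_orbit {lam : Fin n → ℤ} {v : GTIndex n → ℝ} (hv : v ∈ GTPolytope lam)
    (hD : DeletesFrom v 0) : ∃ mu ∈ weightOrbit lam, ∀ i, gtWeight v i = mu i := by
  have h := hD.map_entry_eq (Nat.zero_add n)
  have ha : (fun j : Fin n => entry v 0 j) = fun j => (lam j : ℝ) := by
    ext j
    rw [entry_of_lt v (by omega), hv.1 j]
  rw [ha] at h
  obtain ⟨σ, hσ⟩ : ∃ σ : Equiv.Perm (Fin n), ∀ i : Fin n, rowDiff v (0 + i) = lam (σ i) :=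
    exists_perm_of_map_eq h.symm
  refine ⟨permWeight σ.symm lam, ⟨σ.symm, rfl⟩, fun i => ?_⟩
  have := hσ i
  rw [zero_add] at this
  exact this

end Vertices

theorem mainTheorem2 (n : ℕ) (lam : Fin n → ℤ) (hlam : Antitone lam) :
    -- all the contributions `F(σ(C_v))` are well defined
    (∀ v ∈ GTVertices lam,
      (∃! Q, IsIntegerPointTransform (GTCone lam v) Q) ∧
      (∃! r, IsSpecialization (gtSubst n) (sigma (GTCone lam v)) r)) ∧
    -- the nonzero ones are enumerated by the orbit and given by partial sums of Weyl's formula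
    ∃ e : weightOrbit lam ≃ {v // v ∈ GTVertices lam ∧ specF (sigma (GTCone lam v)) ≠ 0},
      ∀ mu : weightOrbit lam,
        (∀ i, gtWeight (e mu).1 i = (mu.1 i : ℝ)) ∧
        specF (sigma (GTCone lam (e mu).1)) =
          ∑ w : Equiv.Perm (Fin n) with permWeight w lam = mu.1, permRatFn w (weylTerm lam) := by
  have hval : ∀ v ∈ GTVertices lam, specF (sigma (GTCone lam v)) = rowValue v 0 n lam :=
    fun v hv => specF_eq (sigma_GTCone hlam hv.1).2
  refine ⟨fun v hv => ?_, ?_⟩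
  · obtain ⟨h1, h2⟩ := sigma_GTCone hlam hv.1
    exact ⟨h1, _, h2, fun r hr => hr.unique (gtSubst_ne_zero n) h2⟩
  · choose V hV hVD hVw using fun mu : weightOrbit lam => exists_vertex hlam mu.2
    have hVval : ∀ mu : weightOrbit lam, specF (sigma (GTCone lam (V mu))) =
        ∑ w : Equiv.Perm (Fin n) with permWeight w lam = mu.1, permRatFn w (weylTerm lam) :=
      fun mu => by rw [hval _ (hV mu), rowValue_zero_eq (hV mu).1 (hVD mu) (hVw mu)]
    let f : weightOrbit lam → {v // v ∈ GTVertices lam ∧ specF (sigma (GTCone lam v)) ≠ 0} :=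
      fun mu => ⟨V mu, hV mu, by
        rw [hVval mu]
        exact sum_permRatFn_weylTerm_ne_zero hlam mu.2⟩
    have hf : Function.Bijective f := by
      constructor
      · intro mu mu' h
        have hVV : V mu = V mu' := congrArg Subtype.val h
        ext i
        have := hVw mu i
        rw [hVV, hVw mu' i] at this
        exact (Int.cast_injective this).symm
      · rintro ⟨v, hv, hne⟩
        have hD : DeletesFrom v 0 := by
          by_contra hD
          exact hne (by rw [hval v hv, rowValue, if_neg hD])
        obtain ⟨mu, hmu, hw⟩ := exists_weight_mem_orbit hv.1 hD
        refine ⟨⟨mu, hmu⟩, Subtype.ext ?_⟩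
        exact eq_of_gtWeight_eq (hV _).1 hv.1 (hVD _) hD fun i => by rw [hVw, hw]
    exact ⟨Equiv.ofBijective f hf, fun mu => ⟨hVw mu, hVval mu⟩⟩
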